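/- **Setting.** Let $(E,\|\cdot\|)$ be a finite-dimensional real normed space with dual norm $\|\cdot\|_*$, let $X\subseteq E$ be a closed convex set, and consider $$\min_{x\in X}\ \phi(x)=f(x)+\psi(x),\qquad f=\frac1M\sum_{m=1}^M f_m,$$ where $\psi:E\to\mathbb R\cup\{+\infty\}$ is proper, closed and convex, and finite at some point of $X$. Let $M,K,R\ge 1$ be integers (clients, local steps, rounds), and let $\beta,\sigma\ge 0$ and $G,B$ be real numbers. Assume: * each $f_m$ is convex on $X$, differentiable at the points of $X$, and $\beta$-smooth: $f_m(x)\le f_m(x')+\langle\nabla f_m(x'),x-x'\rangle+\frac\beta2\|x-x'\|^2$ for all $x,x'\in X$; * for each client $m$ the stochastic gradient $g_m(x;\xi)$, $\xi\sim\mathcal D_m$, satisfies, for all $x\in X$: $\mathbb E_\xi[g_m(x;\xi)]=\nabla f_m(x)$, $\mathbb E_\xi\|g_m(x;\xi)-\nabla f_m(x)\|_*^2\le\sigma^2$, and $\|g_m(x;\xi)\|_*\le G$ almost surely; all the samples $\xi^m_{r,k},\xi^m_{r,k+1/2}\sim\mathcal D_m$ used below are mutually independent; * $h:E\to\mathbb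 R\cup\{+\infty\}$ is a Legendre function, $X\subseteq\operatorname{int}\operatorname{dom}h$, and $h$ is $1$-strongly convex, i.e. $V^h_{x'}(x):=h(x)-h(x')-\langle\nabla h(x'),x-x'\rangle\ge\frac12\|x-x'\|^2$ for $x\in\operatorname{dom}h$, $x'\in\operatorname{int}\operatorname{dom}h$; moreover $V^h_{x'}(x)\le B$ for all $x,x'\in X$. **Algorithm (FeDualEx, all clients participating, client step size $\eta>0$, server step size $1$).** Let $x_0\in X$, $\bar\varsigma=\nabla h(x_0)$, $\varsigma_0=0$, and $h_{r,k}=h+(rK+k)\eta\psi$. For a function $H$ write $\nabla H^*(s)=\operatorname{argmin}_{x\in X}\{-\langle s,x\rangle+H(x)\}$, $\tilde V^H_s(x)=H(x)-H(x')-\langle s,x-x'\rangle$ with $x'=\nabla H^*(s)$, and $\widetilde{\mathrm{prox}}{}^H_s(g)=\operatorname{argmin}_{x\in X}\{\langle g,x\rangle+\tilde V^H_s(x)\}$. In round $r=0,\dots,R-1$ every client $m$ sets $\varsigma^m_{r,0}=\varsigma_r$ and, for $k=0,\dots,K-1$, $$x^m_{r,k}=\widetilde{\mathrm{prox}}{}^{h_{r,k}}_{\bar\varsigma}(\varsigma^m_{r,k}),\quad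 x^m_{r,k+1/2}=\widetilde{\mathrm{prox}}{}^{h_{r,k+1}}_{\bar\varsigma-\varsigma^m_{r,k}}\big(\eta g_m(x^m_{r,k};\xi^m_{r,k})\big),\quad \varsigma^m_{r,k+1}=\varsigma^m_{r,k}+\eta g_m(x^m_{r,k+1/2};\xi^m_{r,k+1/2});$$ then the server sets $\varsigma_{r+1}=\varsigma_r+\frac1M\sum_m(\varsigma^m_{r,K}-\varsigma_r)$. The averaged-dual intermediate sequence and the output are $$\widehat{x_{r,k+1/2}}=\nabla h_{r,k+1}^*\Big(\frac1M\sum_{m=1}^M\big(\bar\varsigma-\varsigma^m_{r,k}-\eta g_m(x^m_{r,k};\xi^m_{r,k})\big)\Big),\qquad \hat x=\frac1{RK}\sum_{r=0}^{R-1}\sum_{k=0}^{K-1}\widehat{x_{r,k+1/2}}.$$ **Theorem.** For every $\eta>0$, $\hat x$ always lies in $X$ with $\phi(\hat x)$ finite, $\phi(\hat x)$ is integrable, and for every $x\in X$ with $\phi(x)<\infty$, $$\mathbb E[\phi(\hat x)-\phi(x)]\le\frac{B}{\eta RK}+20\beta^2\eta^3K^2G^2+\frac{5\sigma^2\eta}{M}+2\beta\eta^2K^2G^2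 .$$ If moreover $\beta,G,\sigma,B>0$ and $$\eta=\min\Big\{\frac1{5\beta^2},\ \frac{B^{1/4}}{20^{1/4}\beta^{1/2}G^{1/2}K^{3/4}R^{1/4}},\ \frac{B^{1/2}M^{1/2}}{5^{1/2}\sigma R^{1/2}K^{1/2}},\ \frac{B^{1/3}}{2^{1/3}\beta^{1/3}G^{2/3}KR^{1/3}}\Big\},$$ then the same holds with $$\mathbb E[\phi(\hat x)-\phi(x)]\le\frac{5\beta^2B}{RK}+2\cdot\frac{20^{1/4}\beta^{1/2}G^{1/2}B^{3/4}}{K^{1/4}R^{3/4}}+2\cdot\frac{5^{1/2}\sigma B^{1/2}}{M^{1/2}R^{1/2}K^{1/2}}+2\cdot\frac{2^{1/3}\beta^{1/3}G^{2/3}B^{2/3}}{R^{2/3}} .$$ -/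

import Mathlib

open MeasureTheory ProbabilityTheory Set Filter Topology

noncomputable section

namespace FeDualEx

/-! ### Extended-valued convex functions and distance-generating functions -/

/-- The effective domain of an extended-valued function. -/
def effDom {E : Type*} (h : E → EReal) : Set E := {x | h x ≠ ⊤}

/-- The gradient of (the finite part of) an extended-valued function, as an element of the
dual space. -/
def grad {E : Type*} [NormedAddCommGroup E] [NormedSpace ℝ E] (h : E → EReal) (x : E) :
    E →L[ℝ] ℝ :=
  fderiv ℝ (fun y => (h y).toReal) x

/-- `h : E → ℝ ∪ {+∞}` is a proper, convex and closed (lower semicontinuous) function. -/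
structure IsClosedConvexFun {E : Type*} [NormedAddCommGroup E] [NormedSpace ℝ E]
    (h : E → EReal) : Prop where
  ne_bot : ∀ x, h x ≠ ⊥
  proper : ∃ x, h x ≠ ⊤
  convex_epigraph : Convex ℝ {p : E × ℝ | h p.1 ≤ (p.2 : EReal)}
  closed : LowerSemicontinuous h

/-- Legendre functions: proper closed convex functions that are strictly convex on their domain
and essentially smooth. -/
structure IsLegendre {E : Type*} [NormedAddCommGroup E] [NormedSpace ℝ E]
    (h : E → EReal) : Prop extends IsClosedConvexFun h where
  strictConvex : StrictConvexOn ℝ (effDom h) (fun x => (h x).toReal)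
  differentiable : ∀ x ∈ interior (effDom h), DifferentiableAt ℝ (fun y => (h y).toReal) x
  steep : ∀ (u : ℕ → E) (b : E), (∀ n, u n ∈ interior (effDom h)) → b ∈ frontier (effDom h) →
    Tendsto u atTop (𝓝 b) → Tendsto (fun n => ‖grad h (u n)‖) atTop atTop

/-- The Bregman divergence `V^h_{x'}(x) = h(x) - h(x') - ⟨∇h(x'), x - x'⟩`. -/
def bregman {E : Type*} [NormedAddCommGroup E] [NormedSpace ℝ E] (h : E → EReal) (x' x : E) : ℝ :=
  (h x).toReal - (h x').toReal - grad h x' (x - x')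

/-- `h` is `1`-strongly convex with respect to the norm of `E`. -/
def IsOneStronglyConvex {E : Type*} [NormedAddCommGroup E] [NormedSpace ℝ E]
    (h : E → EReal) : Prop :=
  ∀ x ∈ interior (effDom h), ∀ y ∈ effDom h, 1 / 2 * ‖y - x‖ ^ 2 ≤ bregman h x y

/-! ### Generalized Bregman divergence and generalized proximal operator -/

/-- A minimizer of `F` over `X` (an arbitrary point if there is none). -/
def argminOn {E : Type*} [Nonempty E] (X : Set E) (F : E → EReal) : E :=
  Classical.epsilon fun x => x ∈ X ∧ ∀ y ∈ X, F x ≤ F y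

/-- The generalized distance-generating function `h + τ ψ`, with `τ` = (number of iterations) ×
(step size). Here `0 * ⊤ = 0`. -/
def genDGF {E : Type*} (h ψ : E → EReal) (τ : ℝ) (x : E) : EReal :=
  h x + (τ : EReal) * ψ x

/-- The gradient of the conjugate of a generalized distance-generating function `H` on the
domain `X`: `∇H^*(s) = argmin_{x ∈ X} {⟨-s, x⟩ + H(x)}`. -/
def gradConj {E : Type*} [NormedAddCommGroup E] [NormedSpace ℝ E]
    (X : Set E) (H : E → EReal) (s : E →L[ℝ] ℝ) : E :=
  argminOn X fun x => ((-(s x) : ℝ) : EReal) + H x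

/-- The generalized Bregman divergence `H(x) - H(x') - ⟨s, x - x'⟩` with `x' = ∇H^*(s)`. -/
def genBregman {E : Type*} [NormedAddCommGroup E] [NormedSpace ℝ E]
    (X : Set E) (H : E → EReal) (s : E →L[ℝ] ℝ) (x : E) : EReal :=
  H x - H (gradConj X H s) - ((s (x - gradConj X H s) : ℝ) : EReal)

/-- The generalized proximal operator
`argmin_{x ∈ X} {⟨g, x⟩ + (generalized Bregman divergence of x from the dual point s)}`. -/
def genProx {E : Type*} [NormedAddCommGroup E] [NormedSpace ℝ E]
    (X : Set E) (H : E → EReal) (s g : E →L[ℝ] ℝ) : E :=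
  argminOn X fun x => ((g x : ℝ) : EReal) + genBregman X H s x

/-! ### The algorithm -/

/-- The input data and hyperparameters of federated dual extrapolation with `M` clients. -/
structure Input (E Ξ : Type*) [NormedAddCommGroup E] [NormedSpace ℝ E] (M : ℕ) where
  /-- domain of the optimization problem -/
  X : Set E
  /-- distance-generating function -/
  h : E → EReal
  /-- regularizer -/
  ψ : E → EReal
  /-- stochastic gradient `g_m(x; ξ)` of client `m` -/
  oracle : Fin M → E → Ξ → (E →L[ℝ] ℝ)
  /-- fixed point in the dual space -/
  dualBar : E →L[ℝ] ℝ
  /-- number of local updates per round -/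
  K : ℕ
  /-- client step size -/
  ηc : ℝ
  /-- server step size -/
  ηs : ℝ

namespace Input

variable {E Ξ : Type*} [NormedAddCommGroup E] [NormedSpace ℝ E] {M : ℕ}

/-- `h_{r,k} = h + (ηs r K + k) ηc ψ`. -/
def dgf (P : Input E Ξ M) (r k : ℕ) : E → EReal :=
  genDGF P.h P.ψ ((P.ηs * r * P.K + k) * P.ηc)

/-- The primal point computed in local step `k` of round `r` from the local dual variable `ς`. -/
def localPrimal (P : Input E Ξ M) (r k : ℕ) (ς : E →L[ℝ] ℝ) : E :=
  genProx P.X (P.dgf r k) P.dualBar ς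

/-- The intermediate primal point of client `m` in local step `k` of round `r`, computed from the
local dual variable `ς` and the sample `ξ`. -/
def localHalf (P : Input E Ξ M) (m : Fin M) (r k : ℕ) (ς : E →L[ℝ] ℝ) (ξ : Ξ) : E :=
  genProx P.X (P.dgf r (k + 1)) (P.dualBar - ς) (P.ηc • P.oracle m (P.localPrimal r k ς) ξ)

/-- The local dual variable of client `m` after `k` local steps in round `r`, started at `ς₀`.
The samples are `s m r k false` (full step `k`) and `s m r k true` (half step `k + 1/2`). -/
def localDual (P : Input E Ξ M) (s : Fin M → ℕ → ℕ → Bool → Ξ) (m : Fin M) (r : ℕ)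
    (ς₀ : E →L[ℝ] ℝ) : ℕ → (E →L[ℝ] ℝ)
  | 0 => ς₀
  | k + 1 =>
      localDual P s m r ς₀ k + P.ηc •
        P.oracle m (P.localHalf m r k (localDual P s m r ς₀ k) (s m r k false)) (s m r k true)

/-- The server dual variable `ς_r` (all clients participate in every round). -/
def serverDual (P : Input E Ξ M) (s : Fin M → ℕ → ℕ → Bool → Ξ) : ℕ → (E →L[ℝ] ℝ)
  | 0 => 0
  | r + 1 =>
      serverDual P s r + P.ηs • ((1 / M : ℝ) • ∑ m : Fin M,
        (P.localDual s m r (serverDual P s r) P.K - serverDual P s r))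

/-- The dual variable `ς^m_{r,k}` of client `m`. -/
def clientDual (P : Input E Ξ M) (s : Fin M → ℕ → ℕ → Bool → Ξ) (m : Fin M) (r k : ℕ) :
    E →L[ℝ] ℝ :=
  P.localDual s m r (P.serverDual s r) k

/-- The averaged dual `(1/M) ∑ₘ (dualBar - ς^m_{r,k})`. -/
def avgDual (P : Input E Ξ M) (s : Fin M → ℕ → ℕ → Bool → Ξ) (r k : ℕ) : E →L[ℝ] ℝ :=
  (1 / M : ℝ) • ∑ m : Fin M, (P.dualBar - P.clientDual s m r k)

/-- The averaged stochastic gradient `(1/M) ∑ₘ g_m(x^m_{r,k}; ξ^m_{r,k})`. -/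
def avgGrad (P : Input E Ξ M) (s : Fin M → ℕ → ℕ → Bool → Ξ) (r k : ℕ) : E →L[ℝ] ℝ :=
  (1 / M : ℝ) • ∑ m : Fin M,
    P.oracle m (P.localPrimal r k (P.clientDual s m r k)) (s m r k false)

/-- The averaged intermediate dual. -/
def avgDualHalf (P : Input E Ξ M) (s : Fin M → ℕ → ℕ → Bool → Ξ) (r k : ℕ) : E →L[ℝ] ℝ :=
  P.avgDual s r k - P.ηc • P.avgGrad s r k

/-- The primal projection of the averaged intermediate dual. -/
def shadowHalf (P : Input E Ξ M) (s : Fin M → ℕ → ℕ → Bool → Ξ) (r k : ℕ) : E :=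
  gradConj P.X (P.dgf r (k + 1)) (P.avgDualHalf s r k)

/-- The output after `R` rounds: the ergodic average of the intermediate sequence. -/
def output (P : Input E Ξ M) (s : Fin M → ℕ → ℕ → Bool → Ξ) (R : ℕ) : E :=
  (1 / (R * P.K) : ℝ) • ∑ r ∈ Finset.range R, ∑ k ∈ Finset.range P.K, P.shadowHalf s r k

end Input

/-- The composite objective `φ(x) = (1/M) ∑ₘ fₘ(x) + ψ(x)`. -/
def objective {E : Type*} {M : ℕ} (f : Fin M → E → ℝ) (ψ : E → EReal) (x : E) : EReal :=
  (((1 / M : ℝ) * ∑ m, f m x : ℝ) : EReal) + ψ x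

/-- The random point `z` is always feasible with `φ(z)` finite, `φ(z)` has a finite expectation, and
`𝔼[φ(z) - φ(x)] ≤ b` for every `x ∈ X` at which `φ` is finite. -/
def SuboptimalityLE {E Ω : Type*} [MeasurableSpace Ω] (P : Measure Ω) (X : Set E)
    (φ : E → EReal) (z : Ω → E) (b : ℝ) : Prop :=
  (∀ ω, z ω ∈ X ∧ φ (z ω) ≠ ⊥ ∧ φ (z ω) ≠ ⊤) ∧
  Integrable (fun ω => (φ (z ω)).toReal) P ∧
  ∀ x ∈ X, φ x ≠ ⊤ → ∫ ω, ((φ (z ω)).toReal - (φ x).toReal) ∂P ≤ b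

/-- The step size
`min {1/(5β²), B^{1/4}/(20^{1/4} β^{1/2} G^{1/2} K^{3/4} R^{1/4}),
B^{1/2} M^{1/2}/(5^{1/2} σ R^{1/2} K^{1/2}), B^{1/3}/(2^{1/3} β^{1/3} G^{2/3} K R^{1/3})}`. -/
def stepSize (β G σ B : ℝ) (M K R : ℕ) : ℝ :=
  min (min (1 / (5 * β ^ 2))
      (B ^ (1 / 4 : ℝ) / ((20 : ℝ) ^ (1 / 4 : ℝ) * β ^ (1 / 2 : ℝ) * G ^ (1 / 2 : ℝ)
        * (K : ℝ) ^ (3 / 4 : ℝ) * (R : ℝ) ^ (1 / 4 : ℝ))))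
    (min (B ^ (1 / 2 : ℝ) * (M : ℝ) ^ (1 / 2 : ℝ) / ((5 : ℝ) ^ (1 / 2 : ℝ) * σ
        * (R : ℝ) ^ (1 / 2 : ℝ) * (K : ℝ) ^ (1 / 2 : ℝ)))
      (B ^ (1 / 3 : ℝ) / ((2 : ℝ) ^ (1 / 3 : ℝ) * β ^ (1 / 3 : ℝ) * G ^ (2 / 3 : ℝ)
        * K * (R : ℝ) ^ (1 / 3 : ℝ))))

end FeDualEx

end

/-! The argument is a potential-function analysis of dual extrapolation carried out on the averaged
dual variable, with two errors added: the drift of the clients inside a round and the stochastic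
noise.

The potential `Input.gap` is the Fenchel–Young gap between the comparator `x` and the averaged dual,
for the current function `h + τ ψ`. It is nonnegative, is at most `V^h_{x₀}(x) ≤ B` at the start,
and is unchanged by synchronization, because with server step size 1 the server dual is the average
of the client duals. Since `τ` grows by `η` at each step, the increment of the potential produces `η
ψ` at the shadow iterate, next to the linearization of `f`. Summing the one-step inequality
`gap_succ_le` and applying Jensen to the output gives the rate.

The one-step inequality is `extragradient_step`. It uses that the mirror map minimizes a 1-strongly
convex function: it is nonexpansive and the conjugate is smooth. The difference of the gradients at
the two extrapolation points costs `L²`, minus half the squared primal displacement. Bounded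
gradients keep client duals within `O(ηKG)` of their mean, so nonexpansiveness bounds the primal
drift. If `5K²η²β² ≤ 1`, the negative square absorbs the displacement and only drift remains;
otherwise the crude bound `2G` on gradient differences already suffices
(`exists_directional_bound`). Hence no restriction on `η` is needed.

Two points need care. The set `X` may have empty interior, so smoothness on `X` controls gradient
differences only along directions `u - v` with `u, v ∈ X`; `IsSmoothOn.fderiv_sub_le` gives this
with the sharp constant `β`. The norm is arbitrary, so orthogonality of independent noises is
unavailable; the factor `1/M` comes instead from the leave-one-out argument in
`integral_queryNoise_apply_le`. -/

noncomputable section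

namespace FeDualEx

set_option linter.unusedSectionVars false

/-! ### Mirror maps -/

section MirrorMap

variable {E : Type*} [NormedAddCommGroup E] [NormedSpace ℝ E]

/-- `T s` minimizes `H - s` over `Y`, with quadratic growth around the minimizer. -/
structure IsMirrorMap (Y : Set E) (H : E → ℝ) (T : (E →L[ℝ] ℝ) → E) : Prop where
  mem : ∀ s, T s ∈ Y
  growth : ∀ s, ∀ u ∈ Y, H (T s) - s (T s) + 1 / 2 * ‖u - T s‖ ^ 2 ≤ H u - s u

/-- The convex conjugate of `H`, evaluated through its maximizer `T s`. -/
def conj (H : E → ℝ) (T : (E →L[ℝ] ℝ) → E) (s : E →L[ℝ] ℝ) : ℝ := s (T s) - H (T s)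

namespace IsMirrorMap

variable {Y : Set E} {H : E → ℝ} {T : (E →L[ℝ] ℝ) → E}

lemma le_conj (hT : IsMirrorMap Y H T) (s : E →L[ℝ] ℝ) {u : E} (hu : u ∈ Y) :
    s u - H u + 1 / 2 * ‖u - T s‖ ^ 2 ≤ conj H T s := by
  have := hT.growth s u hu
  unfold conj; linarith

lemma fenchel_young (hT : IsMirrorMap Y H T) (s : E →L[ℝ] ℝ) {u : E} (hu : u ∈ Y) :
    0 ≤ conj H T s - s u + H u := by
  have := hT.le_conj s hu
  nlinarith [sq_nonneg ‖u - T s‖]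

/-- Sum of the two growth inequalities, each minimizer being tested against the other. -/
lemma norm_sub_le_of_directional (hT : IsMirrorMap Y H T) (a b : E →L[ℝ] ℝ) :
    ‖T a - T b‖ ^ 2 ≤ (a - b) (T a - T b) := by
  have h1 := hT.growth a (T b) (hT.mem b)
  have h2 := hT.growth b (T a) (hT.mem a)
  rw [norm_sub_rev] at h1
  simp only [sub_apply, map_sub]
  linarith

lemma norm_sub_le (hT : IsMirrorMap Y H T) (a b : E →L[ℝ] ℝ) : ‖T a - T b‖ ≤ ‖a - b‖ := by
  have h1 := hT.norm_sub_le_of_directional a b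
  have h2 := (le_abs_self _).trans ((a - b).le_opNorm (T a - T b))
  by_contra! hlt
  have h3 : 0 < ‖T a - T b‖ := (norm_nonneg _).trans_lt hlt
  nlinarith

lemma continuous (hT : IsMirrorMap Y H T) : Continuous T := by
  refine (LipschitzWith.of_dist_le_mul (K := 1) fun a b => ?_).continuous
  simpa [dist_eq_norm] using hT.norm_sub_le a b

/-- Convexity of the conjugate, from the point of view of the perturbed dual point. -/
lemma conj_add_le (hT : IsMirrorMap Y H T) (b δ : E →L[ℝ] ℝ) :
    conj H T (b + δ) ≤ conj H T b + δ (T (b + δ)) := by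
  have := hT.fenchel_young b (hT.mem (b + δ))
  unfold conj at *
  simp only [add_apply] at *
  linarith

/-- Convexity of the conjugate, with the quadratic remainder. -/
lemma le_conj_add (hT : IsMirrorMap Y H T) (a δ : E →L[ℝ] ℝ) :
    conj H T a + δ (T a) + 1 / 2 * ‖T (a + δ) - T a‖ ^ 2 ≤ conj H T (a + δ) := by
  have := hT.le_conj (a + δ) (hT.mem a)
  rw [norm_sub_rev] at this
  unfold conj at *
  simp only [add_apply] at *
  linarith

/-- Smoothness of the conjugate with respect to directional bounds of the perturbation. -/
lemma conj_add_le_of_directional (hT : IsMirrorMap Y H T) (a δ : E →L[ℝ] ℝ) {L : ℝ}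
    (hL : ∀ u ∈ Y, ∀ v ∈ Y, δ (u - v) ≤ L * ‖u - v‖) :
    conj H T (a + δ) ≤ conj H T a + δ (T a) + 1 / 2 * L ^ 2 := by
  have h1 := hT.le_conj a (hT.mem (a + δ))
  have h2 := hL _ (hT.mem (a + δ)) _ (hT.mem a)
  rw [map_sub] at h2
  unfold conj at *
  simp only [add_apply] at *
  -- Quadratic growth pays for the linear error: `L t - t²/2 ≤ L²/2`.
  nlinarith [sq_nonneg (L - ‖T (a + δ) - T a‖)]

/-- `T` acts as the gradient of the conjugate, so a bound on `Y` is a Lipschitz constant. This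
serves the integrability of the potential. -/
lemma abs_conj_sub_le (hT : IsMirrorMap Y H T) {C : ℝ} (hC : ∀ u ∈ Y, ‖u‖ ≤ C)
    (a b : E →L[ℝ] ℝ) : |conj H T a - conj H T b| ≤ C * ‖a - b‖ := by
  have key : ∀ a b : E →L[ℝ] ℝ, conj H T a - conj H T b ≤ C * ‖a - b‖ := by
    intro a b
    have h1 := hT.conj_add_le b (a - b)
    rw [add_sub_cancel] at h1
    have h2 := (le_abs_self _).trans ((a - b).le_opNorm (T a))
    have h3 := mul_le_mul_of_nonneg_left (hC _ (hT.mem a)) (norm_nonneg (a - b))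
    linarith
  rw [abs_le]
  have h1 := key b a
  rw [norm_sub_rev] at h1
  exact ⟨by linarith, key a b⟩

lemma continuous_conj (hT : IsMirrorMap Y H T) {C : ℝ} (hC : ∀ u ∈ Y, ‖u‖ ≤ C) :
    Continuous (conj H T) := by
  refine (LipschitzWith.of_dist_le_mul (K := C.toNNReal) fun a b => ?_).continuous
  rw [Real.dist_eq, dist_eq_norm]
  refine (hT.abs_conj_sub_le hC a b).trans ?_
  gcongr
  exact Real.le_coe_toNNReal C

/-- One step of dual extrapolation, in terms of mean gradients `g`, `g'` and noises `δ`, `δ'`. -/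
lemma extragradient_step {Y' : Set E} {ψ : E → ℝ} {T' : (E →L[ℝ] ℝ) → E} {η L : ℝ}
    (hT : IsMirrorMap Y H T) (hT' : IsMirrorMap Y' (fun x => H x + η * ψ x) T') (hY : Y' ⊆ Y)
    (s g g' δ δ' : E →L[ℝ] ℝ)
    (hL : ∀ u ∈ Y', ∀ v ∈ Y', (η • g - η • g') (u - v) ≤ L * ‖u - v‖) :
    conj (fun x => H x + η * ψ x) T' (s - η • g' + δ') - conj H T s
        + η * g' (T' (s - η • g + δ)) + η * ψ (T' (s - η • g + δ))
      ≤ L ^ 2 - 1 / 2 * ‖T' (s - η • g + δ) - T s‖ ^ 2 + δ' (T' (s - η • g' + δ'))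
        + δ (T' (s - η • g + δ)) - δ (T' (s - η • g)) := by
  -- The chain removes `δ'`, exchanges `g'` for `g` at cost `L²/2`, then reinstates `δ`. The term `δ
  -- (T' (s - η • g))` is kept because its point does not see the noise `δ`, so it will have mean
  -- zero.
  have h1 := hT'.conj_add_le (s - η • g') δ'
  have h2 := hT'.conj_add_le_of_directional (s - η • g) (η • g - η • g') hL
  rw [sub_add_sub_cancel] at h2
  have h3 := hT'.le_conj_add (s - η • g) δ
  -- Testing the earlier mirror map at the new point leaves the square `‖z - T s‖²` that later
  -- absorbs the displacement.
  have h4 := hT.le_conj s (hY (hT'.mem (s - η • g + δ)))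
  have h5 := hL _ (hT'.mem (s - η • g)) _ (hT'.mem (s - η • g + δ))
  rw [norm_sub_rev] at h5
  set z := T' (s - η • g + δ) with hz
  set w := T' (s - η • g) with hw
  have h6 : conj (fun x => H x + η * ψ x) T' (s - η • g + δ)
      = s z - η * g z + δ z - (H z + η * ψ z) := by
    simp [conj, ← hz]
  -- The second `L²/2`: moving the pairing from `w` to `z` costs `L‖z - w‖`, paid by the half square
  -- in `h3`.
  have h7 := sq_nonneg (L - ‖z - w‖)
  simp only [sub_apply, map_sub, smul_apply,
    smul_eq_mul] at *
  nlinarith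

end IsMirrorMap

end MirrorMap

/-! ### Extended-valued convex functions -/

section Argmin

variable {E : Type*} [Nonempty E]

lemma argminOn_spec {X : Set E} {F : E → EReal} (h : ∃ x ∈ X, ∀ y ∈ X, F x ≤ F y) :
    argminOn X F ∈ X ∧ ∀ y ∈ X, F (argminOn X F) ≤ F y :=
  Classical.epsilon_spec (p := fun x => x ∈ X ∧ ∀ y ∈ X, F x ≤ F y) h

/-- Both problems have the same predicate of minimality, so the choice operator selects the same
point; uniqueness plays no role. -/
lemma argminOn_add_const {X : Set E} {F F' : E → EReal} (c : ℝ)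
    (h : ∀ x ∈ X, F' x = F x + (c : EReal)) : argminOn X F' = argminOn X F := by
  unfold argminOn
  congr 1
  ext x
  refine and_congr_right fun hx => forall₂_congr fun y hy => ?_
  rw [h x hx, h y hy]
  exact (EReal.addLECancellable_coe c).add_le_add_iff_right

end Argmin

/-- The points of `X` at which `h + τ ψ` is finite. -/
def feasible {E : Type*} (X : Set E) (ψ : E → EReal) (τ : ℝ) : Set E := {x | x ∈ X ∧ (τ = 0 ∨ ψ x ≠ ⊤)}

lemma feasible_of_ne_top {E : Type*} {X : Set E} {ψ : E → EReal} {τ : ℝ} {x : E} (hx : x ∈ X)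
    (h' : ψ x ≠ ⊤) : x ∈ feasible X ψ τ :=
  ⟨hx, Or.inr h'⟩

/-- The real-valued version of `h + τ ψ`. -/
def realDGF {E : Type*} (h ψ : E → EReal) (τ : ℝ) (x : E) : ℝ := (h x).toReal + τ * (ψ x).toReal

section Geometry

variable {E : Type*} [NormedAddCommGroup E] [NormedSpace ℝ E]

lemma IsClosedConvexFun.convexOn {ψ : E → EReal} (hψ : IsClosedConvexFun ψ) :
    ConvexOn ℝ (effDom ψ) (fun x => (ψ x).toReal) := by
  have key : ∀ x ∈ effDom ψ, ∀ y ∈ effDom ψ, ∀ a b : ℝ, 0 ≤ a → 0 ≤ b → a + b = 1 →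
      ψ (a • x + b • y) ≤ ((a * (ψ x).toReal + b * (ψ y).toReal : ℝ) : EReal) := by
    intro x hx y hy a b ha hb hab
    have h1 : (x, (ψ x).toReal) ∈ {p : E × ℝ | ψ p.1 ≤ (p.2 : EReal)} :=
      (EReal.coe_toReal hx (hψ.ne_bot x)).ge
    have h2 : (y, (ψ y).toReal) ∈ {p : E × ℝ | ψ p.1 ≤ (p.2 : EReal)} :=
      (EReal.coe_toReal hy (hψ.ne_bot y)).ge
    simpa using hψ.convex_epigraph h1 h2 ha hb hab
  have hmem : ∀ x ∈ effDom ψ, ∀ y ∈ effDom ψ, ∀ a b : ℝ, 0 ≤ a → 0 ≤ b → a + b = 1 →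
      a • x + b • y ∈ effDom ψ := fun x hx y hy a b ha hb hab =>
    ((key x hx y hy a b ha hb hab).trans_lt (EReal.coe_lt_top _)).ne
  refine ⟨fun x hx y hy a b ha hb hab => hmem x hx y hy a b ha hb hab,
    fun x hx y hy a b ha hb hab => ?_⟩
  have h := key x hx y hy a b ha hb hab
  rw [← EReal.coe_toReal (hmem x hx y hy a b ha hb hab) (hψ.ne_bot _), EReal.coe_le_coe_iff] at h
  simpa using h

/-- The convex-analytic data of a composite problem on a compact domain `X`. -/
structure IsGeometry (X : Set E) (h ψ : E → EReal) : Prop where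
  compact : IsCompact X
  convex : Convex ℝ X
  legendre : IsLegendre h
  strong : IsOneStronglyConvex h
  interior : X ⊆ interior (effDom h)
  reg : IsClosedConvexFun ψ
  exists_finite : ∃ x ∈ X, ψ x ≠ ⊤

namespace IsGeometry

variable {X : Set E} {h ψ : E → EReal} {τ : ℝ}

lemma ne_top (hG : IsGeometry X h ψ) {x : E} (hx : x ∈ X) : h x ≠ ⊤ :=
  interior_subset (hG.interior hx)

lemma coe_toReal (hG : IsGeometry X h ψ) {x : E} (hx : x ∈ X) : ((h x).toReal : EReal) = h x :=
  EReal.coe_toReal (hG.ne_top hx) (hG.legendre.ne_bot x)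

lemma genDGF_eq_coe (hG : IsGeometry X h ψ) {x : E} (hx : x ∈ feasible X ψ τ) :
    genDGF h ψ τ x = (realDGF h ψ τ x : EReal) := by
  unfold genDGF realDGF
  rw [EReal.coe_add, hG.coe_toReal hx.1, EReal.coe_mul]
  rcases hx.2 with h0 | h0
  · simp [h0]
  · rw [EReal.coe_toReal h0 (hG.reg.ne_bot x)]

lemma genDGF_eq_top (hG : IsGeometry X h ψ) (hτ : 0 ≤ τ) {x : E} (hx : x ∈ X)
    (hx' : x ∉ feasible X ψ τ) : genDGF h ψ τ x = ⊤ := by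
  have h1 : τ ≠ 0 ∧ ψ x = ⊤ := by
    simpa [feasible, hx, not_or] using hx'
  unfold genDGF
  rw [h1.2, EReal.coe_mul_top_of_pos (lt_of_le_of_ne hτ (Ne.symm h1.1)),
    EReal.add_top_of_ne_bot (hG.legendre.ne_bot x)]

lemma lowerSemicontinuous_genDGF (hG : IsGeometry X h ψ) (hτ : 0 ≤ τ) :
    LowerSemicontinuous (genDGF h ψ τ) := by
  have hmul : LowerSemicontinuous fun x => (τ : EReal) * ψ x := by
    -- At `τ = 0` the convention `0 * ⊤ = 0` makes the product constant; for `τ > 0` multiplication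
    -- by `τ` is continuous and monotone.
    rcases hτ.eq_or_lt with h0 | h0
    · simpa [← h0] using lowerSemicontinuous_const
    · refine Continuous.comp_lowerSemicontinuous (g := fun y : EReal => (τ : EReal) * y) ?_
        hG.reg.closed fun a b hab => mul_le_mul_of_nonneg_left hab (by exact_mod_cast hτ)
      refine continuous_iff_continuousAt.2 fun y => ?_
      have h1 : (τ : EReal) ≠ 0 := by exact_mod_cast h0.ne'
      exact (EReal.continuousAt_mul (p := ((τ : EReal), y)) (Or.inl h1) (Or.inl h1)
        (Or.inl (EReal.coe_ne_bot _)) (Or.inl (EReal.coe_ne_top _))).comp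
        (by fun_prop : ContinuousAt (fun y : EReal => ((τ : EReal), y)) y)
  refine hG.legendre.closed.add' hmul fun x => EReal.continuousAt_add
    (Or.inr ?_) (Or.inl (hG.legendre.ne_bot x))
  rcases hτ.eq_or_lt with h0 | h0
  · simp [← h0]
  · by_cases hx : ψ x = ⊤
    · simp [hx, EReal.coe_mul_top_of_pos h0]
    · rw [← EReal.coe_toReal hx (hG.reg.ne_bot x), ← EReal.coe_mul]
      exact EReal.coe_ne_bot _

lemma exists_minimizer (hG : IsGeometry X h ψ) (hτ : 0 ≤ τ) (s : E →L[ℝ] ℝ) :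
    ∃ x ∈ X, ∀ y ∈ X, ((-(s x) : ℝ) : EReal) + genDGF h ψ τ x
      ≤ ((-(s y) : ℝ) : EReal) + genDGF h ψ τ y := by
  have hlsc : LowerSemicontinuous fun x => ((-(s x) : ℝ) : EReal) + genDGF h ψ τ x := by
    refine LowerSemicontinuous.add' (Continuous.lowerSemicontinuous ?_)
      (hG.lowerSemicontinuous_genDGF hτ) fun x => EReal.continuousAt_add
        (Or.inl (EReal.coe_ne_top _)) (Or.inl (EReal.coe_ne_bot _))
    exact continuous_coe_real_ereal.comp s.continuous.neg
  obtain ⟨x₁, hx₁, -⟩ := hG.exists_finite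
  obtain ⟨x, hx, hmin⟩ := (hlsc.lowerSemicontinuousOn X).exists_isMinOn ⟨x₁, hx₁⟩ hG.compact
  exact ⟨x, hx, fun y hy => hmin hy⟩

lemma bregman_strong (hG : IsGeometry X h ψ) {x y : E} (hx : x ∈ X) (hy : y ∈ X) :
    1 / 2 * ‖y - x‖ ^ 2 ≤ (h y).toReal - (h x).toReal - grad h x (y - x) :=
  hG.strong x (hG.interior hx) y (hG.ne_top hy)

/-- The Bregman bound based at the interpolated point is used at both endpoints. The weights `1 - t`
and `t` cancel the gradient terms, and `(1 - t)t² + t(1 - t)² = t(1 - t)`. -/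
lemma strongly_convex (hG : IsGeometry X h ψ) {x y : E} (hx : x ∈ X) (hy : y ∈ X) {t : ℝ}
    (ht : 0 ≤ t) (ht' : t ≤ 1) :
    (h (x + t • (y - x))).toReal + 1 / 2 * (t * (1 - t)) * ‖y - x‖ ^ 2
      ≤ (1 - t) * (h x).toReal + t * (h y).toReal := by
  have hp : x + t • (y - x) ∈ X := hG.convex.add_smul_sub_mem hx hy ⟨ht, ht'⟩
  have h1 := hG.bregman_strong hp hx
  have h2 := hG.bregman_strong hp hy
  have e1 : x - (x + t • (y - x)) = (-t) • (y - x) := by module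
  have e2 : y - (x + t • (y - x)) = (1 - t) • (y - x) := by module
  rw [e1, norm_smul, mul_pow, Real.norm_eq_abs, sq_abs, map_smul, smul_eq_mul] at h1
  rw [e2, norm_smul, mul_pow, Real.norm_eq_abs, sq_abs, map_smul, smul_eq_mul] at h2
  have h3 := mul_le_mul_of_nonneg_left h1 (sub_nonneg.2 ht')
  have h4 := mul_le_mul_of_nonneg_left h2 ht
  nlinarith

/-- Convexity of `τ ψ` along segments of the feasible set. -/
lemma reg_convex (hG : IsGeometry X h ψ) (hτ : 0 ≤ τ) {x y : E} (hx : x ∈ feasible X ψ τ)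
    (hy : y ∈ feasible X ψ τ) {t : ℝ} (ht : 0 ≤ t) (ht' : t ≤ 1) :
    x + t • (y - x) ∈ feasible X ψ τ ∧
      τ * (ψ (x + t • (y - x))).toReal ≤ (1 - t) * (τ * (ψ x).toReal) + t * (τ * (ψ y).toReal) := by
  have hp : x + t • (y - x) ∈ X := hG.convex.add_smul_sub_mem hx.1 hy.1 ⟨ht, ht'⟩
  rcases hx.2 with h0 | h1
  · simp [h0, feasible, hp]
  rcases hy.2 with h0 | h2
  · simp [h0, feasible, hp]
  have e : x + t • (y - x) = (1 - t) • x + t • y := by module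
  have hc := hG.reg.convexOn
  have h3 := hc.2 h1 h2 (sub_nonneg.2 ht') ht (by ring)
  have h4 := hc.1 h1 h2 (sub_nonneg.2 ht') ht (by ring)
  rw [← e] at h3 h4
  refine ⟨feasible_of_ne_top hp h4, ?_⟩
  have := mul_le_mul_of_nonneg_left h3 hτ
  simp only [smul_eq_mul] at this
  linarith

/-- Compactness and lower semicontinuity give a minimizer, and a point of finite `ψ` makes it
feasible. Comparing it with points of the segment towards `u`, dividing by `t` and letting `t → 0`
yields the growth with the full constant, without optimality conditions for the nonsmooth `ψ`. -/
lemma isMirrorMap (hG : IsGeometry X h ψ) (hτ : 0 ≤ τ) :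
    IsMirrorMap (feasible X ψ τ) (realDGF h ψ τ) (gradConj X (genDGF h ψ τ)) := by
  have spec := fun s => argminOn_spec (hG.exists_minimizer hτ s)
  have hmem : ∀ s, gradConj X (genDGF h ψ τ) s ∈ feasible X ψ τ := by
    intro s
    obtain ⟨x₁, hx₁, hf⟩ := hG.exists_finite
    by_contra hn
    have h1 := (spec s).2 x₁ hx₁
    have h2 := hG.genDGF_eq_top hτ (spec s).1 hn
    rw [h2, hG.genDGF_eq_coe (feasible_of_ne_top hx₁ hf), EReal.coe_add_top,
      ← EReal.coe_add] at h1
    exact EReal.coe_ne_top _ (top_le_iff.1 h1)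
  have hmin : ∀ s, ∀ u ∈ feasible X ψ τ,
      realDGF h ψ τ (gradConj X (genDGF h ψ τ) s) - s (gradConj X (genDGF h ψ τ) s)
        ≤ realDGF h ψ τ u - s u := by
    intro s u hu
    have h1 := (spec s).2 u hu.1
    have h2 := hG.genDGF_eq_coe (hmem s)
    unfold gradConj at h2 ⊢
    rw [h2, hG.genDGF_eq_coe hu, ← EReal.coe_add, ← EReal.coe_add, EReal.coe_le_coe_iff] at h1
    linarith
  refine ⟨hmem, fun s u hu => ?_⟩
  set y := gradConj X (genDGF h ψ τ) s with hy
  have key : ∀ t : ℝ, 0 < t → t ≤ 1 →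
      1 / 2 * (1 - t) * ‖u - y‖ ^ 2 ≤ realDGF h ψ τ u - s u - (realDGF h ψ τ y - s y) := by
    intro t ht ht'
    obtain ⟨hp, hr⟩ := hG.reg_convex hτ (hmem s) hu ht.le ht'
    have h1 := hmin s _ hp
    have h2 := hG.strongly_convex (hmem s).1 hu.1 ht.le ht'
    rw [← hy] at h1 h2 hr
    unfold realDGF at h1 ⊢
    simp only [map_add, map_smul, map_sub, smul_eq_mul] at h1
    have h3 : t * (1 / 2 * (1 - t) * ‖u - y‖ ^ 2)
        ≤ t * ((h u).toReal + τ * (ψ u).toReal - s u - ((h y).toReal + τ * (ψ y).toReal - s y)) := by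
      nlinarith
    exact le_of_mul_le_mul_left h3 ht
  have hlim : Tendsto (fun t : ℝ => 1 / 2 * (1 - t) * ‖u - y‖ ^ 2) (𝓝[>] 0)
      (𝓝 (1 / 2 * (1 - 0) * ‖u - y‖ ^ 2)) :=
    (Continuous.tendsto (by fun_prop) 0).mono_left nhdsWithin_le_nhds
  have := le_of_tendsto hlim (by
    filter_upwards [Ioc_mem_nhdsGT one_pos] with t ht using key t ht.1 ht.2)
  linarith

/-- The generalized Bregman divergence from `s` is `H - s` up to a constant, so every proximal step
is the mirror map at a shifted dual point. -/
lemma genProx_eq (hG : IsGeometry X h ψ) (hτ : 0 ≤ τ) (s g : E →L[ℝ] ℝ) :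
    genProx X (genDGF h ψ τ) s g = gradConj X (genDGF h ψ τ) (s - g) := by
  have hm := (hG.isMirrorMap hτ).mem s
  refine argminOn_add_const
    (s (gradConj X (genDGF h ψ τ) s) - realDGF h ψ τ (gradConj X (genDGF h ψ τ) s)) fun x hx => ?_
  unfold genBregman
  rw [hG.genDGF_eq_coe hm]
  by_cases hf : x ∈ feasible X ψ τ
  · rw [hG.genDGF_eq_coe hf]
    norm_cast
    simp only [map_sub, sub_apply]
    ring
  · rw [hG.genDGF_eq_top hτ hx hf, EReal.top_sub_coe, EReal.top_sub_coe, EReal.coe_add_top,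
      EReal.coe_add_top, EReal.top_add_coe]

lemma continuousOn (hG : IsGeometry X h ψ) : ContinuousOn (fun x => (h x).toReal) X :=
  fun x hx => (hG.legendre.differentiable x (hG.interior hx)).continuousAt.continuousWithinAt

/-- A closed convex function is bounded below on a compact set. -/
lemma reg_bddBelow (hG : IsGeometry X h ψ) : ∃ c : ℝ, ∀ x ∈ X, ψ x ≠ ⊤ → c ≤ (ψ x).toReal := by
  obtain ⟨x₁, hx₁, hf⟩ := hG.exists_finite
  obtain ⟨x, hx, hmin⟩ := (hG.reg.closed.lowerSemicontinuousOn X).exists_isMinOn ⟨x₁, hx₁⟩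
    hG.compact
  exact ⟨(ψ x).toReal, fun y hy hfy => EReal.toReal_le_toReal (hmin hy) (hG.reg.ne_bot x) hfy⟩

end IsGeometry

end Geometry

/-! ### Convex functions that are smooth on a convex set -/

section Smooth

variable {E : Type*} [NormedAddCommGroup E] [NormedSpace ℝ E]

/-- `f` is convex on `X`, differentiable at the points of `X`, and satisfies the descent inequality
with constant `β` between points of `X`. -/
structure IsSmoothOn (X : Set E) (f : E → ℝ) (β : ℝ) : Prop where
  convexOn : ConvexOn ℝ X f
  differentiable : ∀ x ∈ X, DifferentiableAt ℝ f x
  smooth : ∀ x ∈ X, ∀ x' ∈ X, f x ≤ f x' + fderiv ℝ f x' (x - x') + β / 2 * ‖x - x'‖ ^ 2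

namespace IsSmoothOn

variable {X : Set E} {f : E → ℝ} {β : ℝ}

lemma continuousOn (hf : IsSmoothOn X f β) : ContinuousOn f X :=
  fun x hx => (hf.differentiable x hx).continuousAt.continuousWithinAt

lemma gradient_inequality (hf : IsSmoothOn X f β) {x x' : E} (hx : x ∈ X) (hx' : x' ∈ X) :
    f x' + fderiv ℝ f x' (x - x') ≤ f x := by
  have h1 : HasDerivAt (fun t : ℝ => f (x' + t • (x - x'))) (fderiv ℝ f x' (x - x')) 0 := by
    have hl : HasDerivAt (fun t : ℝ => x' + t • (x - x')) (x - x') 0 := by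
      simpa using ((hasDerivAt_id (0 : ℝ)).smul_const (x - x')).const_add x'
    have hf' : HasFDerivAt f (fderiv ℝ f x') (x' + (0 : ℝ) • (x - x')) := by
      simpa using (hf.differentiable x' hx').hasFDerivAt
    exact hf'.comp_hasDerivAt 0 hl
  have h2 := h1.tendsto_slope_zero_right
  have h3 : fderiv ℝ f x' (x - x') ≤ f x - f x' := by
    refine le_of_tendsto h2 ?_
    filter_upwards [Ioc_mem_nhdsGT one_pos] with t ht
    have hc := hf.convexOn.2 hx' hx (sub_nonneg.2 ht.2) ht.1.le (by ring)
    have e : x' + t • (x - x') = (1 - t) • x' + t • x := by module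
    simp only [smul_eq_mul] at hc
    simp only [zero_add, zero_smul, add_zero, smul_eq_mul]
    rw [inv_mul_le_iff₀ ht.1, e]
    linarith
  linarith

/-- A substitute for the Lipschitz continuity of the gradient that involves only points of `X`. -/
lemma four_point (hf : IsSmoothOn X f β) {x x' u v : E} (hx : x ∈ X) (hx' : x' ∈ X) (hu : u ∈ X)
    (hv : v ∈ X) : (fderiv ℝ f x - fderiv ℝ f x') (u - v)
      ≤ β / 2 * (‖u - x'‖ ^ 2 + ‖v - x‖ ^ 2) := by
  have h1 := hf.gradient_inequality hu hx
  have h2 := hf.smooth u hu x' hx'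
  have h3 := hf.gradient_inequality hv hx'
  have h4 := hf.smooth v hv x hx
  simp only [sub_apply, map_sub] at *
  linarith

/-- `four_point` is applied at the test points `(a + b)/2 ± (s/2) w`, with `s` chosen so that `s w`
is as long as `a - b`. They then lie within `‖a - b‖` of `b` and `a` respectively, which gives
exactly `β`. -/
lemma fderiv_sub_le_of_mem (hf : IsSmoothOn X f β) (hβ : 0 ≤ β) {a b w : E} (ha : a ∈ X)
    (hb : b ∈ X) {ε : ℝ} (hw : 0 < ‖w‖) (hab : ‖a - b‖ ≤ ε * ‖w‖)
    (hmem : ∀ t : ℝ, |t| ≤ ε / 2 → (1 / 2 : ℝ) • (a + b) + t • w ∈ X) :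
    (fderiv ℝ f a - fderiv ℝ f b) w ≤ β * ‖a - b‖ * ‖w‖ := by
  rcases (norm_nonneg (a - b)).eq_or_lt with h0 | h0
  · have : a = b := sub_eq_zero.1 (norm_eq_zero.1 h0.symm)
    simp [this]
  set s : ℝ := ‖a - b‖ / ‖w‖ with hs
  have hs0 : 0 < s := div_pos h0 hw
  have hsw : s * ‖w‖ = ‖a - b‖ := div_mul_cancel₀ _ hw.ne'
  have hsε : s ≤ ε := (div_le_iff₀ hw).2 hab
  have hu := hmem (s / 2) (by rw [abs_of_pos (by positivity)]; linarith)
  have hv := hmem (-(s / 2)) (by rw [abs_neg, abs_of_pos (by positivity)]; linarith)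
  have h1 := hf.four_point ha hb hu hv
  have e1 : (1 / 2 : ℝ) • (a + b) + (s / 2) • w - ((1 / 2 : ℝ) • (a + b) + (-(s / 2)) • w)
      = s • w := by module
  have e2 : (1 / 2 : ℝ) • (a + b) + (s / 2) • w - b = (1 / 2 : ℝ) • (a - b) + (s / 2) • w := by
    module
  have e3 : (1 / 2 : ℝ) • (a + b) + (-(s / 2)) • w - a
      = -((1 / 2 : ℝ) • (a - b) + (s / 2) • w) := by module
  have h2 : ‖(1 / 2 : ℝ) • (a - b) + (s / 2) • w‖ ≤ ‖a - b‖ := by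
    refine (norm_add_le _ _).trans ?_
    rw [norm_smul, norm_smul, Real.norm_of_nonneg (by norm_num), Real.norm_of_nonneg (by positivity)]
    linarith
  rw [e1, e2, e3, norm_neg, map_smul, smul_eq_mul] at h1
  have h3 : ‖(1 / 2 : ℝ) • (a - b) + (s / 2) • w‖ ^ 2 ≤ ‖a - b‖ ^ 2 := by gcongr
  have h4 : s * (fderiv ℝ f a - fderiv ℝ f b) w ≤ s * (β * ‖a - b‖ * ‖w‖) := by
    have : s * (β * ‖a - b‖ * ‖w‖) = β * ‖a - b‖ ^ 2 := by rw [← hsw]; ring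
    rw [this]
    nlinarith
  exact le_of_mul_le_mul_left h4 hs0

/-- The segment is cut into pieces short compared with the available room `ε‖w‖`; the bounds on the
pieces telescope without loss in the constant. -/
lemma fderiv_sub_le_of_segment (hf : IsSmoothOn X f β) (hβ : 0 ≤ β) {x y w : E} {ε : ℝ}
    (hε : 0 < ε)
    (hmem : ∀ l : ℝ, 0 ≤ l → l ≤ 1 → ∀ t : ℝ, |t| ≤ ε / 2 → x + l • (y - x) + t • w ∈ X) :
    (fderiv ℝ f x - fderiv ℝ f y) w ≤ β * ‖x - y‖ * ‖w‖ := by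
  rcases (norm_nonneg w).eq_or_lt with h0 | hw
  · simp [norm_eq_zero.1 h0.symm]
  obtain ⟨n, hn⟩ := exists_nat_gt (‖x - y‖ / (ε * ‖w‖))
  have hn0 : 0 < (n : ℝ) := lt_of_le_of_lt (by positivity) hn
  set p : ℕ → E := fun i => x + ((i : ℝ) / n) • (y - x) with hp
  have hl : ∀ i : ℕ, i ≤ n → 0 ≤ (i : ℝ) / n ∧ (i : ℝ) / n ≤ 1 := fun i hi =>
    ⟨by positivity, (div_le_one hn0).2 (by exact_mod_cast hi)⟩
  have hpX : ∀ i : ℕ, i ≤ n → p i ∈ X := by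
    intro i hi
    simpa using hmem _ (hl i hi).1 (hl i hi).2 0 (by rw [abs_zero]; positivity)
  have hstep : ∀ i ∈ Finset.range n,
      fderiv ℝ f (p i) w - fderiv ℝ f (p (i + 1)) w ≤ β * (‖x - y‖ / n) * ‖w‖ := by
    intro i hi
    have hi' : i + 1 ≤ n := Finset.mem_range.1 hi
    have e1 : p i - p (i + 1) = (1 / (n : ℝ)) • (x - y) := by
      simp only [hp]; push_cast
      rw [add_div]; module
    have e2 : ‖p i - p (i + 1)‖ = ‖x - y‖ / n := by
      rw [e1, norm_smul, Real.norm_of_nonneg (by positivity)]; ring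
    have h1 := hf.fderiv_sub_le_of_mem hβ (hpX i (by omega)) (hpX (i + 1) hi') (ε := ε) hw
      (by
        rw [e2, div_le_iff₀ hn0]
        rw [div_lt_iff₀ (by positivity)] at hn
        linarith)
      (by
        intro t ht
        have e3 : (1 / 2 : ℝ) • (p i + p (i + 1))
            = x + ((((i : ℝ) / n) + ((i + 1 : ℕ) : ℝ) / n) / 2) • (y - x) := by
          simp only [hp]; module
        rw [e3]
        have := hl i (by omega)
        have := hl (i + 1) hi'
        exact hmem _ (by linarith) (by linarith) t ht)
    rw [e2] at h1
    simpa using h1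
  have hsum := Finset.sum_le_sum hstep
  rw [Finset.sum_range_sub' (fun i => fderiv ℝ f (p i) w)] at hsum
  have e0 : p 0 = x := by simp [hp]
  have en : p n = y := by simp [hp, div_self hn0.ne']
  rw [e0, en] at hsum
  simp only [Finset.sum_const, Finset.card_range, nsmul_eq_mul] at hsum
  calc (fderiv ℝ f x - fderiv ℝ f y) w = fderiv ℝ f x w - fderiv ℝ f y w := by simp
    _ ≤ _ := hsum
    _ = β * ‖x - y‖ * ‖w‖ := by field_simp

/-- Shrinking `u` and `v` towards `x` by `ε` puts them within `2εd` of `x'` and `εd` of `x`;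
`four_point` then gives `β/2 · (4 + 1) ε²d²`. After cancelling `ε` the error vanishes with `ε`. -/
lemma fderiv_sub_le_perturbed (hf : IsSmoothOn X f β) (hβ : 0 ≤ β) {x x' u v : E} {d ε : ℝ}
    (hx : x ∈ X) (hx' : x' ∈ X) (hu : u ∈ X) (hv : v ∈ X) (hε : 0 ≤ ε) (hε' : ε ≤ 1)
    (hxx' : ‖x - x'‖ ≤ ε * d) (hd : ‖u - x‖ ≤ d) (hd' : ‖v - x‖ ≤ d) :
    ε * (fderiv ℝ f x - fderiv ℝ f x') (u - v) ≤ ε * (5 / 2 * β * ε * d ^ 2) := by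
  have hc := hf.convexOn.1
  have h1 := hf.four_point hx hx' (hc.add_smul_sub_mem hx hu ⟨hε, hε'⟩)
    (hc.add_smul_sub_mem hx hv ⟨hε, hε'⟩)
  have e1 : x + ε • (u - x) - (x + ε • (v - x)) = ε • (u - v) := by module
  have e2 : x + ε • (u - x) - x' = (x - x') + ε • (u - x) := by module
  have h2 : ‖(x - x') + ε • (u - x)‖ ≤ 2 * (ε * d) := by
    refine (norm_add_le _ _).trans ?_
    rw [norm_smul, Real.norm_of_nonneg hε]
    nlinarith
  have h3 : ‖ε • (v - x)‖ ≤ ε * d := by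
    rw [norm_smul, Real.norm_of_nonneg hε]; gcongr
  rw [e1, e2, add_sub_cancel_left, map_smul, smul_eq_mul] at h1
  have h4 : ‖(x - x') + ε • (u - x)‖ ^ 2 ≤ (2 * (ε * d)) ^ 2 := by gcongr
  have h5 : ‖ε • (v - x)‖ ^ 2 ≤ (ε * d) ^ 2 := by gcongr
  nlinarith

/-- Along directions of `X`, the gradient is `β`-Lipschitz on `X`. -/
lemma fderiv_sub_le (hf : IsSmoothOn X f β) (hβ : 0 ≤ β) {x y u v : E} (hx : x ∈ X) (hy : y ∈ X)
    (hu : u ∈ X) (hv : v ∈ X) :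
    (fderiv ℝ f x - fderiv ℝ f y) (u - v) ≤ β * ‖x - y‖ * ‖u - v‖ := by
  have hc := hf.convexOn.1
  set c : E := (1 / 2 : ℝ) • (u + v) with hcdef
  have hcX : c ∈ X := by
    have := hc hu hv (a := 1 / 2) (b := 1 / 2) (by norm_num) (by norm_num) (by norm_num)
    rwa [← smul_add] at this
  obtain ⟨d, hd⟩ : ∃ d : ℝ, ∀ a ∈ ({u, v, c} : Set E), ∀ b ∈ ({x, y} : Set E),
      ‖a - b‖ ≤ d ∧ ‖a - (b + (c - b))‖ ≤ d := by
    refine ⟨‖u - x‖ + ‖u - y‖ + ‖v - x‖ + ‖v - y‖ + ‖c - x‖ + ‖c - y‖ + ‖u - c‖ + ‖v - c‖, ?_⟩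
    intro a ha b hb
    have := norm_nonneg (u - x); have := norm_nonneg (u - y); have := norm_nonneg (v - x)
    have := norm_nonneg (v - y); have := norm_nonneg (c - x); have := norm_nonneg (c - y)
    have := norm_nonneg (u - c); have := norm_nonneg (v - c)
    rcases ha with rfl | rfl | rfl <;> rcases hb with rfl | rfl <;>
      simp only [add_sub_cancel, sub_self, norm_zero] <;> constructor <;> linarith
  have hball : ∀ a ∈ ({u, v} : Set E), ∀ b ∈ ({x, y} : Set E), ∀ ε : ℝ, 0 ≤ ε → ε ≤ 1 →
      ‖a - (b + ε • (c - b))‖ ≤ d := by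
    intro a ha b hb ε h0 h1
    have ha' : a ∈ ({u, v, c} : Set E) := by rcases ha with rfl | rfl <;> simp
    have e : a - (b + ε • (c - b)) = (1 - ε) • (a - b) + ε • (a - (b + (c - b))) := by module
    rw [e]
    refine (norm_add_le _ _).trans ?_
    rw [norm_smul, norm_smul, Real.norm_of_nonneg h0, Real.norm_of_nonneg (sub_nonneg.2 h1)]
    have := mul_le_mul_of_nonneg_left (hd a ha' b hb).1 (sub_nonneg.2 h1)
    have := mul_le_mul_of_nonneg_left (hd a ha' b hb).2 h0
    linarith
  -- Both `x` and `y` are pulled by `ε` towards the midpoint `c` of `u, v`. The segment between the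
  -- new points has room `ε/2` along `u - v`, so the sharp bound holds there, while each of the two
  -- displacements costs `O(ε)`.
  have key : ∀ ε : ℝ, 0 < ε → ε ≤ 1 → (fderiv ℝ f x - fderiv ℝ f y) (u - v)
      ≤ 5 / 2 * β * ε * d ^ 2 + β * ((1 - ε) * ‖x - y‖) * ‖u - v‖ + 5 / 2 * β * ε * d ^ 2 := by
    intro ε h0 h1
    have hxε := hc.add_smul_sub_mem hx hcX ⟨h0.le, h1⟩
    have hyε := hc.add_smul_sub_mem hy hcX ⟨h0.le, h1⟩
    have hnx : ‖ε • (c - x)‖ ≤ ε * d := by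
      rw [norm_smul, Real.norm_of_nonneg h0.le]
      exact mul_le_mul_of_nonneg_left (hd c (by simp) x (by simp)).1 h0.le
    have hny : ‖ε • (c - y)‖ ≤ ε * d := by
      rw [norm_smul, Real.norm_of_nonneg h0.le]
      exact mul_le_mul_of_nonneg_left (hd c (by simp) y (by simp)).1 h0.le
    have k1 := le_of_mul_le_mul_left (hf.fderiv_sub_le_perturbed hβ hx hxε hu hv h0.le h1
      (by simpa [norm_neg] using hnx) (hd u (by simp) x (by simp)).1
      (hd v (by simp) x (by simp)).1) h0
    have k2 := le_of_mul_le_mul_left (hf.fderiv_sub_le_perturbed hβ hyε hy hu hv h0.le h1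
      (by simpa using hny) (hball u (by simp) y (by simp) ε h0.le h1)
      (hball v (by simp) y (by simp) ε h0.le h1)) h0
    have k3 := hf.fderiv_sub_le_of_segment hβ (x := x + ε • (c - x)) (y := y + ε • (c - y))
      (w := u - v) h0 (by
        intro l hl hl' t ht
        -- A shift by `t (u - v)` is placed entirely on `c`, which enters with weight `ε`; since
        -- `|t/ε| ≤ 1/2` the shifted point stays on the segment from `v` to `u`.
        have hq : c + (t / ε) • (u - v) ∈ X := by
          have ht' : |t / ε| ≤ 1 / 2 := by
            rw [abs_div, abs_of_pos h0, div_le_iff₀ h0]; linarith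
          obtain ⟨h5, h6⟩ := abs_le.1 ht'
          have := hc hu hv (a := 1 / 2 + t / ε) (b := 1 / 2 - t / ε) (by linarith) (by linarith)
            (by ring)
          have e : c + (t / ε) • (u - v) = (1 / 2 + t / ε) • u + (1 / 2 - t / ε) • v := by
            rw [hcdef]; module
          rwa [e]
        have hz := hc.add_smul_sub_mem hx hy ⟨hl, hl'⟩
        have := hc.add_smul_sub_mem hz hq ⟨h0.le, h1⟩
        convert this using 1
        have e4 : t • (u - v) = ε • ((t / ε) • (u - v)) := by
          rw [smul_smul, mul_div_cancel₀ _ h0.ne']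
        rw [e4]; module)
    have e5 : x + ε • (c - x) - (y + ε • (c - y)) = (1 - ε) • (x - y) := by module
    rw [e5, norm_smul, Real.norm_of_nonneg (sub_nonneg.2 h1)] at k3
    simp only [sub_apply] at *
    linarith
  have hlim : Tendsto (fun ε : ℝ => 5 / 2 * β * ε * d ^ 2 + β * ((1 - ε) * ‖x - y‖) * ‖u - v‖
      + 5 / 2 * β * ε * d ^ 2) (𝓝[>] 0) (𝓝 (5 / 2 * β * 0 * d ^ 2
        + β * ((1 - 0) * ‖x - y‖) * ‖u - v‖ + 5 / 2 * β * 0 * d ^ 2)) :=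
    (Continuous.tendsto (by fun_prop) 0).mono_left nhdsWithin_le_nhds
  have := ge_of_tendsto hlim (by
    filter_upwards [Ioc_mem_nhdsGT one_pos] with ε hε using key ε hε.1 hε.2)
  simpa using this

end IsSmoothOn

end Smooth

/-! ### Stochastic oracles queried at independent points -/

section Probability

variable {Ω Ξ : Type*} [MeasurableSpace Ω] [MeasurableSpace Ξ] {P : Measure Ω}
  [IsProbabilityMeasure P]

/-- Freezing: the joint law is a product, so by Fubini the independent variable can be held fixed
while the sample is integrated out. -/
lemma IndepFun.integral_eq {F : Type*} [MeasurableSpace F] {x : Ω → F} {V : Ω → Ξ}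
    (hx : Measurable x) (hV : Measurable V) (hind : IndepFun x V P) {f : F × Ξ → ℝ}
    (hf : Measurable f) (hint : Integrable (fun ω => f (x ω, V ω)) P) :
    ∫ ω, f (x ω, V ω) ∂P = ∫ ω, ∫ ξ, f (x ω, ξ) ∂(P.map V) ∂P := by
  have hlaw := (indepFun_iff_map_prod_eq_prod_map_map hx.aemeasurable hV.aemeasurable).1 hind
  have : IsProbabilityMeasure (P.map V) := Measure.isProbabilityMeasure_map hV.aemeasurable
  have h1 : ∫ ω, f (x ω, V ω) ∂P = ∫ p, f p ∂(P.map fun ω => (x ω, V ω)) :=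
    (integral_map (hx.prodMk hV).aemeasurable hf.aestronglyMeasurable).symm
  have h2 : Integrable f (P.map fun ω => (x ω, V ω)) :=
    (integrable_map_measure hf.aestronglyMeasurable (hx.prodMk hV).aemeasurable).2 hint
  rw [hlaw] at h2
  rw [h1, hlaw, integral_prod _ h2, integral_map hx.aemeasurable]
  exact (hf.stronglyMeasurable.integral_prod_right' (f := f)).aestronglyMeasurable

lemma IndepFun.ae_of_forall_ae {F : Type*} [MeasurableSpace F] {x : Ω → F} {V : Ω → Ξ}
    (hx : Measurable x) (hV : Measurable V) (hind : IndepFun x V P) {p : F × Ξ → Prop}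
    (hp : MeasurableSet {y | p y}) (h : ∀ ω, ∀ᵐ ξ ∂(P.map V), p (x ω, ξ)) :
    ∀ᵐ ω ∂P, p (x ω, V ω) := by
  have hlaw := (indepFun_iff_map_prod_eq_prod_map_map hx.aemeasurable hV.aemeasurable).1 hind
  have : IsProbabilityMeasure (P.map V) := Measure.isProbabilityMeasure_map hV.aemeasurable
  refine ae_of_ae_map (hx.prodMk hV).aemeasurable (p := p) ?_
  rw [hlaw, ae_iff]
  change ((P.map x).prod (P.map V)) {y | p y}ᶜ = 0
  rw [Measure.prod_apply hp.compl, lintegral_map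
    (measurable_measure_prodMk_left hp.compl) hx]
  have h0 : ∀ ω, P.map V (Prod.mk (x ω) ⁻¹' {y | p y}ᶜ) = 0 := fun ω => ae_iff.1 (h ω)
  simp only [h0, lintegral_zero]

variable {E : Type*} [NormedAddCommGroup E] [NormedSpace ℝ E] [MeasurableSpace E] [BorelSpace E]

/-- A stochastic oracle `g` on `X`, driven by samples of law `D`, with mean `grad`, variance at most
`σ²` and norm at most `G`. -/
structure IsOracle (X : Set E) (D : Measure Ξ) (g : E → Ξ → (E →L[ℝ] ℝ)) (grad : E → (E →L[ℝ] ℝ))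
    (σ G : ℝ) : Prop where
  measurable : Measurable (fun p : E × Ξ => g p.1 p.2)
  unbiased : ∀ x ∈ X, ∫ ξ, g x ξ ∂D = grad x
  variance : ∀ x ∈ X, ∫ ξ, ‖g x ξ - grad x‖ ^ 2 ∂D ≤ σ ^ 2
  bounded : ∀ x ∈ X, ∀ᵐ ξ ∂D, ‖g x ξ‖ ≤ G

namespace IsOracle

variable [FiniteDimensional ℝ E] {X : Set E} {D : Measure Ξ}
  {g : E → Ξ → (E →L[ℝ] ℝ)} {grad : E → (E →L[ℝ] ℝ)} {σ G : ℝ}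

lemma measurable_sample {Ω' : Type*} {m : MeasurableSpace Ω'} {x : Ω' → E} {V : Ω' → Ξ}
    (hg : IsOracle X D g grad σ G) (hx : Measurable x) (hV : Measurable V) :
    Measurable (fun ω => g (x ω) (V ω)) :=
  hg.measurable.comp (hx.prodMk hV)

variable [IsProbabilityMeasure D]

lemma norm_grad_le (hg : IsOracle X D g grad σ G) {x : E} (hx : x ∈ X) : ‖grad x‖ ≤ G := by
  rw [← hg.unbiased x hx]
  simpa using norm_integral_le_of_norm_le_const (hg.bounded x hx)

lemma measurable_mean (hg : IsOracle X D g grad σ G) :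
    Measurable (fun e => ∫ ξ, g e ξ ∂D) :=
  (hg.measurable.stronglyMeasurable.integral_prod_right (f := fun e ξ => g e ξ)).measurable

/-- On `X` the gradient is the mean of the oracle, a parametric integral, hence measurable in the
parameter. -/
lemma measurable_grad {Ω' : Type*} {m : MeasurableSpace Ω'} {x : Ω' → E}
    (hg : IsOracle X D g grad σ G) (hx : Measurable x) (hxX : ∀ ω, x ω ∈ X) :
    Measurable (fun ω => grad (x ω)) := by
  have : (fun ω => grad (x ω)) = fun ω => ∫ ξ, g (x ω) ξ ∂D :=
    funext fun ω => (hg.unbiased _ (hxX ω)).symm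
  rw [this]
  exact hg.measurable_mean.comp hx

lemma integrable (hg : IsOracle X D g grad σ G) {x : E} (hx : x ∈ X) : Integrable (g x) D :=
  Integrable.of_bound (hg.measurable.comp measurable_prodMk_left).aestronglyMeasurable G
    (hg.bounded x hx)

variable {V : Ω → Ξ} {x : Ω → E}

lemma ae_norm_le (hg : IsOracle X D g grad σ G) (hV : Measurable V) (hD : P.map V = D)
    (hx : Measurable x) (hxX : ∀ ω, x ω ∈ X) (hind : IndepFun x V P) :
    ∀ᵐ ω ∂P, ‖g (x ω) (V ω)‖ ≤ G :=
  IndepFun.ae_of_forall_ae hx hV hind (p := fun y => ‖g y.1 y.2‖ ≤ G)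
    (measurableSet_le hg.measurable.norm measurable_const)
    fun ω => by rw [hD]; exact hg.bounded _ (hxX ω)

lemma ae_norm_noise_le (hg : IsOracle X D g grad σ G) (hV : Measurable V) (hD : P.map V = D)
    (hx : Measurable x) (hxX : ∀ ω, x ω ∈ X) (hind : IndepFun x V P) :
    ∀ᵐ ω ∂P, ‖g (x ω) (V ω) - grad (x ω)‖ ≤ 2 * G := by
  filter_upwards [hg.ae_norm_le hV hD hx hxX hind] with ω hω
  have := hg.norm_grad_le (hxX ω)
  exact (norm_sub_le _ _).trans (by linarith)

lemma measurable_noise {Ω' : Type*} {m : MeasurableSpace Ω'} {x : Ω' → E} {V : Ω' → Ξ}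
    (hg : IsOracle X D g grad σ G) (hx : Measurable x)
    (hxX : ∀ ω, x ω ∈ X) (hV : Measurable V) : Measurable fun ω => g (x ω) (V ω) - grad (x ω) :=
  (hg.measurable_sample hx hV).sub (hg.measurable_grad hx hxX)

lemma integrable_sq_noise (hg : IsOracle X D g grad σ G) (hV : Measurable V) (hD : P.map V = D)
    (hx : Measurable x) (hxX : ∀ ω, x ω ∈ X) (hind : IndepFun x V P) :
    Integrable (fun ω => ‖g (x ω) (V ω) - grad (x ω)‖ ^ 2) P := by
  refine Integrable.of_bound ((hg.measurable_noise hx hxX hV).norm.pow_const 2).aestronglyMeasurable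
    ((2 * G) ^ 2) ?_
  filter_upwards [hg.ae_norm_noise_le hV hD hx hxX hind] with ω hω
  rw [Real.norm_of_nonneg (by positivity)]
  gcongr

lemma integral_sq_noise_le (hg : IsOracle X D g grad σ G) (hV : Measurable V) (hD : P.map V = D)
    (hx : Measurable x) (hxX : ∀ ω, x ω ∈ X) (hind : IndepFun x V P) :
    ∫ ω, ‖g (x ω) (V ω) - grad (x ω)‖ ^ 2 ∂P ≤ σ ^ 2 := by
  have hint := hg.integrable_sq_noise hV hD hx hxX hind
  have hmean : ∀ ω, ∫ ξ, g (x ω) ξ ∂D = grad (x ω) := fun ω => hg.unbiased _ (hxX ω)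
  have h1 := IndepFun.integral_eq hx hV hind
    (f := fun y => ‖g y.1 y.2 - ∫ ξ, g y.1 ξ ∂D‖ ^ 2)
    ((hg.measurable.sub (hg.measurable_mean.comp measurable_fst)).norm.pow_const 2)
    (by simpa only [hmean] using hint)
  simp only [hmean, hD] at h1
  rw [h1]
  calc ∫ ω, ∫ ξ, ‖g (x ω) ξ - grad (x ω)‖ ^ 2 ∂D ∂P ≤ ∫ _, σ ^ 2 ∂P :=
        integral_mono_of_nonneg (ae_of_all _ fun ω => integral_nonneg fun ξ => by positivity)
          (integrable_const _) (ae_of_all _ fun ω => hg.variance _ (hxX ω))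
    _ = σ ^ 2 := by simp

lemma integrable_noise_apply (hg : IsOracle X D g grad σ G) (hV : Measurable V)
    (hD : P.map V = D) (hx : Measurable x) (hxX : ∀ ω, x ω ∈ X) (hind : IndepFun x V P)
    {z : Ω → E} (hz : Measurable z) {C : ℝ} (hzC : ∀ ω, ‖z ω‖ ≤ C) :
    Integrable (fun ω => (g (x ω) (V ω) - grad (x ω)) (z ω)) P := by
  have hpair : Continuous fun q : (E →L[ℝ] ℝ) × E => q.1 q.2 :=
    isBoundedBilinearMap_apply.continuous
  refine Integrable.of_bound (hpair.measurable.comp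
    ((hg.measurable_noise hx hxX hV).prodMk hz)).aestronglyMeasurable (2 * G * C) ?_
  filter_upwards [hg.ae_norm_noise_le hV hD hx hxX hind] with ω hω
  refine (ContinuousLinearMap.le_opNorm _ _).trans ?_
  have := (norm_nonneg _).trans hω
  exact mul_le_mul hω (hzC ω) (norm_nonneg _) this

/-- The test vector may be random, provided that it is jointly with `x` independent of the sample;
freezing both reduces the claim to unbiasedness. -/
lemma integral_noise_apply (hg : IsOracle X D g grad σ G) (hV : Measurable V)
    (hD : P.map V = D) (hx : Measurable x) (hxX : ∀ ω, x ω ∈ X)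
    {z : Ω → E} (hz : Measurable z) {C : ℝ} (hzC : ∀ ω, ‖z ω‖ ≤ C)
    (hind : IndepFun (fun ω => (x ω, z ω)) V P) :
    ∫ ω, (g (x ω) (V ω) - grad (x ω)) (z ω) ∂P = 0 := by
  have hind' : IndepFun x V P := hind.comp measurable_fst measurable_id
  have hint := hg.integrable_noise_apply hV hD hx hxX hind' hz hzC
  have hmean : ∀ ω, ∫ ξ, g (x ω) ξ ∂D = grad (x ω) := fun ω => hg.unbiased _ (hxX ω)
  have hpair : Continuous fun q : (E →L[ℝ] ℝ) × E => q.1 q.2 :=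
    isBoundedBilinearMap_apply.continuous
  have hmeas : Measurable fun y : (E × E) × Ξ => (g y.1.1 y.2 - ∫ ξ, g y.1.1 ξ ∂D) y.1.2 := by
    refine hpair.measurable.comp (Measurable.prodMk ?_ (measurable_snd.comp measurable_fst))
    exact (hg.measurable.comp ((measurable_fst.comp measurable_fst).prodMk measurable_snd)).sub
      (hg.measurable_mean.comp (measurable_fst.comp measurable_fst))
  have h1 := IndepFun.integral_eq (hx.prodMk hz) hV hind hmeas (by simpa only [hmean] using hint)
  simp only [hmean, hD] at h1
  rw [h1]
  refine integral_eq_zero_of_ae (ae_of_all _ fun ω => ?_)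
  have hgi := hg.integrable (hxX ω)
  have h2 := ContinuousLinearMap.integral_apply (hgi.sub (integrable_const (grad (x ω)))) (z ω)
  simp only [Pi.sub_apply] at h2
  refine h2.symm.trans ?_
  rw [integral_sub hgi (integrable_const _), hmean]
  simp

end IsOracle

/-! ### σ-algebras generated by subfamilies of the independent samples. -/

lemma IndepFun.of_measurable {Ω Ξ F : Type*} {m : MeasurableSpace Ω} {mΩ : MeasurableSpace Ω}
    [MeasurableSpace Ξ] [MeasurableSpace F] {P : Measure Ω} {V : Ω → Ξ}
    (hind : Indep m (MeasurableSpace.comap V inferInstance) P) {x : Ω → F}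
    (hx : Measurable[m] x) : IndepFun x V P :=
  (IndepFun_iff_Indep x V P).2 (indep_of_indep_of_le_left hind hx.comap_le)

/-- The σ-algebra generated by the samples with index in `S`. -/
abbrev sampleAlg {I Ω Ξ : Type*} [MeasurableSpace Ξ] (ξ : I → Ω → Ξ) (S : Set I) : MeasurableSpace Ω :=
  ⨆ i ∈ S, MeasurableSpace.comap (ξ i) inferInstance

section SampleAlg

variable {I : Type*} {ξ : I → Ω → Ξ} {S S' : Set I}

lemma sampleAlg_mono (h : S ⊆ S') : sampleAlg ξ S ≤ sampleAlg ξ S' :=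
  biSup_mono fun _ hi => h hi

lemma sampleAlg_le (hξ : ∀ i, Measurable (ξ i)) : sampleAlg ξ S ≤ ‹MeasurableSpace Ω› :=
  iSup₂_le fun i _ => (hξ i).comap_le

lemma measurable_sampleAlg {i : I} (hi : i ∈ S) : Measurable[sampleAlg ξ S] (ξ i) :=
  measurable_iff_comap_le.2 (le_iSup₂_of_le i hi le_rfl)

lemma indepFun_sampleAlg (hξ : ∀ i, Measurable (ξ i)) (hind : iIndepFun ξ P) {i : I} (hi : i ∉ S)
    {F : Type*} [MeasurableSpace F] {x : Ω → F} (hx : Measurable[sampleAlg ξ S] x) :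
    IndepFun x (ξ i) P := by
  refine IndepFun.of_measurable ?_ hx
  have h := indep_iSup_of_disjoint (fun j => (hξ j).comap_le) hind.iIndep
    (Set.disjoint_singleton_right.2 hi)
  rwa [iSup_singleton] at h

end SampleAlg

/-! ### Noise of an averaged gradient and leave-one-out variance reduction. -/

section LeaveOneOut

variable [FiniteDimensional ℝ E] {M : ℕ} {I : Type*} {ξ : I → Ω → Ξ} {i : Fin M → I} {S : Set I}
  {X : Set E} {D : Fin M → Measure Ξ} {g : Fin M → E → Ξ → (E →L[ℝ] ℝ)}
  {grad : Fin M → E → (E →L[ℝ] ℝ)} {σ G : ℝ} {x : Fin M → Ω → E}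

/-- Samples queried by `M` clients at points that depend only on earlier samples. -/
structure IsQuery (P : Measure Ω) (ξ : I → Ω → Ξ) (i : Fin M → I) (S : Set I) (X : Set E)
    (D : Fin M → Measure Ξ) (g : Fin M → E → Ξ → (E →L[ℝ] ℝ)) (grad : Fin M → E → (E →L[ℝ] ℝ))
    (σ G : ℝ) (x : Fin M → Ω → E) : Prop where
  measurable_sample : ∀ j, Measurable (ξ j)
  indep : iIndepFun ξ P
  law : ∀ m, P.map (ξ (i m)) = D m
  injective : Function.Injective i
  fresh : ∀ m, i m ∉ S
  oracle : ∀ m, IsOracle X (D m) (g m) (grad m) σ G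
  measurable : ∀ m, Measurable[sampleAlg ξ S] (x m)
  mem : ∀ m ω, x m ω ∈ X

/-- The scaled difference of the average gradient and the average stochastic gradient. -/
def queryNoise (ξ : I → Ω → Ξ) (i : Fin M → I) (g : Fin M → E → Ξ → (E →L[ℝ] ℝ))
    (grad : Fin M → E → (E →L[ℝ] ℝ)) (x : Fin M → Ω → E) (η : ℝ) (ω : Ω) : E →L[ℝ] ℝ :=
  ∑ m, (-(η / M)) • (g m (x m ω) (ξ (i m) ω) - grad m (x m ω))

namespace IsQuery

lemma isProbabilityMeasure (hq : IsQuery P ξ i S X D g grad σ G x) (m : Fin M) :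
    IsProbabilityMeasure (D m) := by
  rw [← hq.law m]
  exact Measure.isProbabilityMeasure_map (hq.measurable_sample _).aemeasurable

lemma measurable' (hq : IsQuery P ξ i S X D g grad σ G x) (m : Fin M) : Measurable (x m) :=
  (hq.measurable m).mono (sampleAlg_le hq.measurable_sample) le_rfl

lemma indepFun (hq : IsQuery P ξ i S X D g grad σ G x) (m : Fin M) :
    IndepFun (x m) (ξ (i m)) P :=
  indepFun_sampleAlg hq.measurable_sample hq.indep (hq.fresh m) (hq.measurable m)

lemma ae_norm_le (hq : IsQuery P ξ i S X D g grad σ G x) (m : Fin M) :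
    ∀ᵐ ω ∂P, ‖g m (x m ω) (ξ (i m) ω)‖ ≤ G := by
  have := hq.isProbabilityMeasure m
  exact (hq.oracle m).ae_norm_le (hq.measurable_sample _) (hq.law m) (hq.measurable' m) (hq.mem m)
    (hq.indepFun m)

lemma integrable_noise_apply (hq : IsQuery P ξ i S X D g grad σ G x) (m : Fin M) {w : Ω → E}
    (hw : Measurable w) {C : ℝ} (hC : ∀ ω, ‖w ω‖ ≤ C) :
    Integrable (fun ω => (g m (x m ω) (ξ (i m) ω) - grad m (x m ω)) (w ω)) P := by
  have := hq.isProbabilityMeasure m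
  exact (hq.oracle m).integrable_noise_apply (hq.measurable_sample _) (hq.law m)
    (hq.measurable' m) (hq.mem m) (hq.indepFun m) hw hC

lemma measurable_noise (hq : IsQuery P ξ i S X D g grad σ G x) (m : Fin M) {S' : Set I}
    (hS : S ⊆ S') (hi : i m ∈ S') :
    Measurable[sampleAlg ξ S'] fun ω => g m (x m ω) (ξ (i m) ω) - grad m (x m ω) := by
  have := hq.isProbabilityMeasure m
  exact (hq.oracle m).measurable_noise ((hq.measurable m).mono (sampleAlg_mono hS) le_rfl)
    (hq.mem m) (measurable_sampleAlg hi)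

lemma integral_noise_apply (hq : IsQuery P ξ i S X D g grad σ G x) (m : Fin M) {S' : Set I}
    (hS : S ⊆ S') (hi : i m ∉ S') {w : Ω → E} (hw : Measurable[sampleAlg ξ S'] w) {C : ℝ}
    (hC : ∀ ω, ‖w ω‖ ≤ C) :
    ∫ ω, (g m (x m ω) (ξ (i m) ω) - grad m (x m ω)) (w ω) ∂P = 0 := by
  have := hq.isProbabilityMeasure m
  exact (hq.oracle m).integral_noise_apply (hq.measurable_sample _) (hq.law m)
    (hq.measurable' m) (hq.mem m) (hw.mono (sampleAlg_le hq.measurable_sample) le_rfl) hC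
    (indepFun_sampleAlg hq.measurable_sample hq.indep hi
      (((hq.measurable m).mono (sampleAlg_mono hS) le_rfl).prodMk hw))

lemma queryNoise_apply (η : ℝ) (w : E) (ω : Ω) : queryNoise ξ i g grad x η ω w
    = ∑ m, -(η / M) * (g m (x m ω) (ξ (i m) ω) - grad m (x m ω)) w := by
  simp [queryNoise]

lemma integrable_queryNoise_apply (hq : IsQuery P ξ i S X D g grad σ G x) (η : ℝ) {w : Ω → E}
    (hw : Measurable w) {C : ℝ} (hC : ∀ ω, ‖w ω‖ ≤ C) :
    Integrable (fun ω => queryNoise ξ i g grad x η ω (w ω)) P := by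
  simp only [queryNoise_apply]
  exact integrable_finsetSum _ fun m _ => (hq.integrable_noise_apply m hw hC).const_mul _

lemma integral_queryNoise_apply (hq : IsQuery P ξ i S X D g grad σ G x) (η : ℝ) {w : Ω → E}
    (hw : Measurable[sampleAlg ξ S] w) {C : ℝ} (hC : ∀ ω, ‖w ω‖ ≤ C) :
    ∫ ω, queryNoise ξ i g grad x η ω (w ω) ∂P = 0 := by
  have hw' : Measurable w := hw.mono (sampleAlg_le hq.measurable_sample) le_rfl
  simp only [queryNoise_apply]
  rw [integral_finsetSum _ fun m _ => (hq.integrable_noise_apply m hw' hC).const_mul _]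
  refine Finset.sum_eq_zero fun m _ => ?_
  rw [integral_const_mul, hq.integral_noise_apply m subset_rfl (hq.fresh m) hw hC, mul_zero]

lemma measurable_queryNoise (hq : IsQuery P ξ i S X D g grad σ G x) (η : ℝ) {S' : Set I}
    (hS : S ⊆ S') (hi : ∀ m, i m ∈ S') :
    Measurable[sampleAlg ξ S'] (queryNoise ξ i g grad x η) := by
  unfold queryNoise
  exact Finset.measurable_fun_sum _ fun m _ => (hq.measurable_noise m hS (hi m)).const_smul (-(η / M))

/-- Variance reduction by averaging, valid for every norm: the average noise is paired with a
nonexpansive function of itself, from which one client's contribution is removed at a time. -/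
lemma integral_queryNoise_apply_le (hq : IsQuery P ξ i S X D g grad σ G x) (hM : 0 < M) (η : ℝ)
    {T : (E →L[ℝ] ℝ) → E} (hT : ∀ a b, ‖T a - T b‖ ≤ ‖a - b‖) {C : ℝ} (hC : ∀ s, ‖T s‖ ≤ C)
    {a : Ω → (E →L[ℝ] ℝ)} (ha : Measurable[sampleAlg ξ S] a) :
    Integrable (fun ω => queryNoise ξ i g grad x η ω (T (a ω + queryNoise ξ i g grad x η ω))) P ∧
    ∫ ω, queryNoise ξ i g grad x η ω (T (a ω + queryNoise ξ i g grad x η ω)) ∂P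
      ≤ η ^ 2 * σ ^ 2 / M := by
  have hTc : Continuous T :=
    (LipschitzWith.of_dist_le_mul (K := 1) fun a b => by simpa [dist_eq_norm] using hT a b).continuous
  set ζ : Fin M → Ω → (E →L[ℝ] ℝ) := fun m ω => g m (x m ω) (ξ (i m) ω) - grad m (x m ω) with hζ
  set δ : Ω → (E →L[ℝ] ℝ) := queryNoise ξ i g grad x η with hδ
  have hle : sampleAlg ξ S ≤ ‹MeasurableSpace Ω› := sampleAlg_le hq.measurable_sample
  have hδm : Measurable δ :=
    (hq.measurable_queryNoise η (subset_univ S) fun _ => mem_univ _).mono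
      (sampleAlg_le hq.measurable_sample) le_rfl
  have hTm : Measurable fun ω => T (a ω + δ ω) :=
    hTc.measurable.comp ((ha.mono hle le_rfl).add hδm)
  have hint : Integrable (fun ω => δ ω (T (a ω + δ ω))) P :=
    hq.integrable_queryNoise_apply η hTm fun ω => hC _
  refine ⟨hint, ?_⟩
  -- For each client `m` the relevant σ-algebra contains every sample except that of `m`, so it sees
  -- the past and the other clients' noises of the same query.
  have hSm : ∀ m, S ⊆ {i m}ᶜ := fun m j hj => by rintro rfl; exact hq.fresh m hj
  have hrem : ∀ m, Measurable[sampleAlg ξ {i m}ᶜ]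
      fun ω => ∑ m' ∈ Finset.univ.erase m, (-(η / M)) • ζ m' ω := fun m =>
    Finset.measurable_fun_sum _ fun m' hm' => (hq.measurable_noise m'
      (hSm m) fun h => (Finset.ne_of_mem_erase hm') (hq.injective h)).const_smul (-(η / M))
  have hsplit : ∀ m ω, δ ω = (-(η / M)) • ζ m ω
      + ∑ m' ∈ Finset.univ.erase m, (-(η / M)) • ζ m' ω := fun m ω =>
    (Finset.add_sum_erase Finset.univ (fun m' => (-(η / M)) • ζ m' ω) (Finset.mem_univ m)).symm
  have hout : ∀ m, Measurable[sampleAlg ξ {i m}ᶜ] fun ω =>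
      T (a ω + ∑ m' ∈ Finset.univ.erase m, (-(η / M)) • ζ m' ω) := fun m =>
    hTc.measurable.comp ((ha.mono (sampleAlg_mono (hSm m)) le_rfl).add (hrem m))
  -- With its own contribution removed from the argument of `T`, the noise of client `m` pairs to
  -- zero in expectation. Nonexpansiveness bounds the change by one factor of the scaled noise,
  -- which leaves its square.
  have hterm : ∀ m, ∫ ω, -(η / M) * ζ m ω (T (a ω + δ ω)) ∂P ≤ (η / M) ^ 2 * σ ^ 2 := by
    intro m
    have := hq.isProbabilityMeasure m
    have hz := hq.integral_noise_apply m (hSm m) (by simp) (hout m) fun ω => hC _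
    have hzi := hq.integrable_noise_apply m
      ((hout m).mono (sampleAlg_le hq.measurable_sample) le_rfl) fun ω => hC _
    have hsq := (hq.oracle m).integral_sq_noise_le (hq.measurable_sample _) (hq.law m)
      (hq.measurable' m) (hq.mem m) (hq.indepFun m)
    have hsqi := (hq.oracle m).integrable_sq_noise (hq.measurable_sample _) (hq.law m)
      (hq.measurable' m) (hq.mem m) (hq.indepFun m)
    calc ∫ ω, -(η / M) * ζ m ω (T (a ω + δ ω)) ∂P
        ≤ ∫ ω, (-(η / M) * ζ m ω (T (a ω + ∑ m' ∈ Finset.univ.erase m, (-(η / M)) • ζ m' ω))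
            + (η / M) ^ 2 * ‖ζ m ω‖ ^ 2) ∂P := by
          refine integral_mono ((hq.integrable_noise_apply m hTm fun ω => hC _).const_mul _)
            ((hzi.const_mul _).add (hsqi.const_mul _)) fun ω => ?_
          set z := T (a ω + δ ω)
          set z' := T (a ω + ∑ m' ∈ Finset.univ.erase m, (-(η / M)) • ζ m' ω)
          have h1 : ‖z - z'‖ ≤ ‖(-(η / M)) • ζ m ω‖ := by
            refine (hT _ _).trans (le_of_eq ?_)
            rw [hsplit m ω]; congr 1; abel
          have h2 : ((-(η / M)) • ζ m ω) (z - z') ≤ ‖(-(η / M)) • ζ m ω‖ ^ 2 := by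
            refine ((le_abs_self _).trans (ContinuousLinearMap.le_opNorm ((-(η / M)) • ζ m ω) _)).trans ?_
            rw [sq]
            exact mul_le_mul_of_nonneg_left h1 (norm_nonneg _)
          rw [norm_smul, mul_pow, Real.norm_eq_abs, sq_abs, neg_sq, smul_apply, map_sub,
            smul_eq_mul, mul_sub] at h2
          linarith
      _ = (η / M) ^ 2 * ∫ ω, ‖ζ m ω‖ ^ 2 ∂P := by
          rw [integral_add (hzi.const_mul _) (hsqi.const_mul _), integral_const_mul,
            integral_const_mul, hz, mul_zero, zero_add]
      _ ≤ (η / M) ^ 2 * σ ^ 2 := by gcongr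
  have hM' : (M : ℝ) ≠ 0 := by exact_mod_cast hM.ne'
  calc ∫ ω, δ ω (T (a ω + δ ω)) ∂P = ∑ m, ∫ ω, -(η / M) * ζ m ω (T (a ω + δ ω)) ∂P := by
        rw [← integral_finsetSum _ fun m _ =>
          (hq.integrable_noise_apply m hTm fun ω => hC _).const_mul _]
        exact integral_congr_ae (ae_of_all _ fun ω => queryNoise_apply η _ ω)
    _ ≤ ∑ _m : Fin M, (η / M) ^ 2 * σ ^ 2 := Finset.sum_le_sum fun m _ => hterm m
    _ = η ^ 2 * σ ^ 2 / M := by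
        simp only [Finset.sum_const, Finset.card_univ, Fintype.card_fin, nsmul_eq_mul]
        field_simp

end IsQuery

end LeaveOneOut

end Probability

/-! ### Pathwise analysis of federated dual extrapolation -/

section Average

variable {V : Type*} [NormedAddCommGroup V] [NormedSpace ℝ V] {M : ℕ}

lemma smul_sum_const (hM : 0 < M) (v : V) : (1 / M : ℝ) • ∑ _m : Fin M, v = v := by
  have hM' : (M : ℝ) ≠ 0 := by exact_mod_cast hM.ne'
  rw [Finset.sum_const, Finset.card_univ, Fintype.card_fin, ← Nat.cast_smul_eq_nsmul ℝ, smul_smul,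
    one_div_mul_cancel hM', one_smul]

lemma norm_average_le (hM : 0 < M) {v : Fin M → V} {c : ℝ} (h : ∀ m, ‖v m‖ ≤ c) :
    ‖(1 / M : ℝ) • ∑ m, v m‖ ≤ c := by
  rw [norm_smul, Real.norm_of_nonneg (by positivity)]
  calc (1 / M : ℝ) * ‖∑ m, v m‖ ≤ (1 / M : ℝ) * ∑ _m : Fin M, c := by
        gcongr
        exact norm_sum_le_of_le _ fun m _ => h m
    _ = c := smul_sum_const hM c

lemma average_le {v : Fin M → ℝ} {c : ℝ} (hM : 0 < M) (h : ∀ m, v m ≤ c) :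
    (1 / M : ℝ) * ∑ m, v m ≤ c := by
  calc (1 / M : ℝ) * ∑ m, v m ≤ (1 / M : ℝ) * ∑ _m : Fin M, c := by
        gcongr with m; exact h m
    _ = c := smul_sum_const hM c

end Average

/-- The constants fit the step analysis: under `5K²η²β² ≤ 1` the `u²` term, times `η²β²`, is at most
`u²/2`, and with `a = ηG` the other term is the drift error `20β²η⁴K²G²`. -/
lemma add_sq_le_of_one_le {K : ℝ} (hK : 1 ≤ K) (u a : ℝ) :
    (u + (4 * K - 2) * a) ^ 2 ≤ 5 / 2 * K ^ 2 * u ^ 2 + 20 * K ^ 2 * a ^ 2 := by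
  have hp : 0 < 5 / 2 * K ^ 2 - 1 := by nlinarith
  -- Discriminant condition of the quadratic form in `(u, a)`; the left side equals `5/2 · K² (4K² +
  -- 16K - 12)`.
  have h1 : 0 ≤ (5 / 2 * K ^ 2 - 1) * (20 * K ^ 2 - (4 * K - 2) ^ 2) - (4 * K - 2) ^ 2 := by
    nlinarith [mul_nonneg (sq_nonneg K) (by nlinarith : (0 : ℝ) ≤ 4 * K ^ 2 + 16 * K - 12)]
  have h2 : 0 ≤ (5 / 2 * K ^ 2 - 1)
      * (5 / 2 * K ^ 2 * u ^ 2 + 20 * K ^ 2 * a ^ 2 - (u + (4 * K - 2) * a) ^ 2) := by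
    have e : (5 / 2 * K ^ 2 - 1)
        * (5 / 2 * K ^ 2 * u ^ 2 + 20 * K ^ 2 * a ^ 2 - (u + (4 * K - 2) * a) ^ 2)
        = ((5 / 2 * K ^ 2 - 1) * u - (4 * K - 2) * a) ^ 2
          + a ^ 2 * ((5 / 2 * K ^ 2 - 1) * (20 * K ^ 2 - (4 * K - 2) ^ 2) - (4 * K - 2) ^ 2) := by
      ring
    rw [e]
    positivity
  linarith [nonneg_of_mul_nonneg_right h2 hp]

section Pathwise

variable {E Ξ : Type*} [NormedAddCommGroup E] [NormedSpace ℝ E] {M : ℕ}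

/-- A problem instance together with the regularity of the client objectives. -/
structure IsProblem (Q : Input E Ξ M) (f : Fin M → E → ℝ) (β G : ℝ) : Prop where
  geom : IsGeometry Q.X Q.h Q.ψ
  clients_pos : 0 < M
  ηc_pos : 0 < Q.ηc
  ηs_eq : Q.ηs = 1
  β_nonneg : 0 ≤ β
  smooth : ∀ m, IsSmoothOn Q.X (f m) β
  norm_fderiv_le : ∀ m, ∀ x ∈ Q.X, ‖fderiv ℝ (f m) x‖ ≤ G

namespace Input

/-- The weight of the regularizer after `k` local steps of round `r`. -/
def time (Q : Input E Ξ M) (r k : ℕ) : ℝ := (r * Q.K + k) * Q.ηc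

/-- The mirror map used in local step `k` of round `r`. -/
def mirror (Q : Input E Ξ M) (r k : ℕ) : (E →L[ℝ] ℝ) → E := gradConj Q.X (Q.dgf r k)

/-- The point `x^m_{r,k}`. -/
def point (Q : Input E Ξ M) (s : Fin M → ℕ → ℕ → Bool → Ξ) (r k : ℕ) (m : Fin M) : E :=
  Q.localPrimal r k (Q.clientDual s m r k)

/-- The point `x^m_{r,k+1/2}`. -/
def pointHalf (Q : Input E Ξ M) (s : Fin M → ℕ → ℕ → Bool → Ξ) (r k : ℕ) (m : Fin M) : E :=
  Q.localHalf m r k (Q.clientDual s m r k) (s m r k false)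

/-- The average of the client gradients at the points `x m`. -/
def meanGrad (f : Fin M → E → ℝ) (x : Fin M → E) : E →L[ℝ] ℝ :=
  (1 / M : ℝ) • ∑ m, fderiv ℝ (f m) (x m)

/-- The noise of the average stochastic gradient, for the samples of kind `b`, queried at `x m`. -/
def noise (Q : Input E Ξ M) (f : Fin M → E → ℝ) (s : Fin M → ℕ → ℕ → Bool → Ξ) (r k : ℕ) (b : Bool)
    (x : Fin M → E) : E →L[ℝ] ℝ :=
  ∑ m, (-(Q.ηc / M)) • (Q.oracle m (x m) (s m r k b) - fderiv ℝ (f m) (x m))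

/-- All the stochastic gradients used by the algorithm have norm at most `G`. -/
def BoundedOracle (Q : Input E Ξ M) (s : Fin M → ℕ → ℕ → Bool → Ξ) (G : ℝ) : Prop :=
  ∀ r k m, ‖Q.oracle m (Q.point s r k m) (s m r k false)‖ ≤ G ∧
    ‖Q.oracle m (Q.pointHalf s r k m) (s m r k true)‖ ≤ G

/-- The generalized Bregman divergence between the comparator `x` and the averaged dual iterate. -/
def gap (Q : Input E Ξ M) (s : Fin M → ℕ → ℕ → Bool → Ξ) (x : E) (r k : ℕ) : ℝ :=
  conj (realDGF Q.h Q.ψ (Q.time r k)) (Q.mirror r k) (Q.avgDual s r k) - Q.avgDual s r k x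
    + realDGF Q.h Q.ψ (Q.time r k) x

end Input

/-- The composite objective as a real number. -/
def realObjective (f : Fin M → E → ℝ) (ψ : E → EReal) (x : E) : ℝ :=
  (1 / M : ℝ) * ∑ m, f m x + (ψ x).toReal

namespace IsProblem

open Input

variable {Q : Input E Ξ M} {f : Fin M → E → ℝ} {β G : ℝ} {s : Fin M → ℕ → ℕ → Bool → Ξ}

lemma time_nonneg (hQ : IsProblem Q f β G) (r k : ℕ) : 0 ≤ Q.time r k := by
  have := hQ.ηc_pos
  unfold time; positivity

lemma time_succ (Q : Input E Ξ M) (r k : ℕ) : Q.time r (k + 1) = Q.time r k + Q.ηc := by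
  unfold time; push_cast; ring

lemma dgf_eq (hQ : IsProblem Q f β G) (r k : ℕ) : Q.dgf r k = genDGF Q.h Q.ψ (Q.time r k) := by
  unfold dgf time
  rw [hQ.ηs_eq, one_mul]

lemma dgf_next (hQ : IsProblem Q f β G) (r : ℕ) : Q.dgf (r + 1) 0 = Q.dgf r Q.K := by
  rw [hQ.dgf_eq, hQ.dgf_eq]
  congr 1
  unfold time; push_cast; ring

lemma isMirrorMap (hQ : IsProblem Q f β G) (r k : ℕ) :
    IsMirrorMap (feasible Q.X Q.ψ (Q.time r k)) (realDGF Q.h Q.ψ (Q.time r k)) (Q.mirror r k) := by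
  unfold mirror
  rw [hQ.dgf_eq]
  exact hQ.geom.isMirrorMap (hQ.time_nonneg r k)

lemma mirror_mem (hQ : IsProblem Q f β G) (r k : ℕ) (a : E →L[ℝ] ℝ) : Q.mirror r k a ∈ Q.X :=
  ((hQ.isMirrorMap r k).mem a).1

/-- After a step the weight of `ψ` is positive, which excludes the alternative `τ = 0` in
`feasible`. At time zero the mirror point may have `ψ = ⊤`; the output averages only points with
positive weight. -/
lemma mirror_succ_ne_top (hQ : IsProblem Q f β G) (r k : ℕ) (a : E →L[ℝ] ℝ) :
    Q.ψ (Q.mirror r (k + 1) a) ≠ ⊤ := by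
  have h1 := hQ.time_nonneg r k
  have h2 := hQ.ηc_pos
  have h3 := time_succ Q r k
  exact ((hQ.isMirrorMap r (k + 1)).mem a).2.resolve_left (by linarith)

lemma genProx_eq (hQ : IsProblem Q f β G) (r k : ℕ) (a b : E →L[ℝ] ℝ) :
    genProx Q.X (Q.dgf r k) a b = Q.mirror r k (a - b) := by
  unfold mirror
  rw [hQ.dgf_eq]
  exact hQ.geom.genProx_eq (hQ.time_nonneg r k) a b

lemma point_eq (hQ : IsProblem Q f β G) (r k : ℕ) (m : Fin M) :
    Q.point s r k m = Q.mirror r k (Q.dualBar - Q.clientDual s m r k) :=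
  hQ.genProx_eq r k _ _

lemma pointHalf_eq (hQ : IsProblem Q f β G) (r k : ℕ) (m : Fin M) :
    Q.pointHalf s r k m = Q.mirror r (k + 1) (Q.dualBar - Q.clientDual s m r k
      - Q.ηc • Q.oracle m (Q.point s r k m) (s m r k false)) :=
  hQ.genProx_eq r (k + 1) _ _

lemma point_mem (hQ : IsProblem Q f β G) (r k : ℕ) (m : Fin M) : Q.point s r k m ∈ Q.X := by
  rw [hQ.point_eq]; exact hQ.mirror_mem _ _ _

lemma pointHalf_mem (hQ : IsProblem Q f β G) (r k : ℕ) (m : Fin M) :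
    Q.pointHalf s r k m ∈ Q.X := by
  rw [hQ.pointHalf_eq]; exact hQ.mirror_mem _ _ _

lemma clientDual_succ (Q : Input E Ξ M) (s : Fin M → ℕ → ℕ → Bool → Ξ) (m : Fin M) (r k : ℕ) :
    Q.clientDual s m r (k + 1) = Q.clientDual s m r k
      + Q.ηc • Q.oracle m (Q.pointHalf s r k m) (s m r k true) := rfl

lemma noise_eq (Q : Input E Ξ M) (f : Fin M → E → ℝ) (s : Fin M → ℕ → ℕ → Bool → Ξ) (r k : ℕ) (b : Bool) (x : Fin M → E) :
    Q.noise f s r k b x = Q.ηc • meanGrad f x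
      - Q.ηc • ((1 / M : ℝ) • ∑ m, Q.oracle m (x m) (s m r k b)) := by
  ext w
  simp only [noise, meanGrad, sum_apply, sub_apply, smul_apply, smul_eq_mul, Finset.mul_sum,
    ← Finset.sum_sub_distrib]
  exact Finset.sum_congr rfl fun m _ => by ring

lemma avgDualHalf_eq (Q : Input E Ξ M) (f : Fin M → E → ℝ) (s : Fin M → ℕ → ℕ → Bool → Ξ) (r k : ℕ) : Q.avgDualHalf s r k
    = Q.avgDual s r k - Q.ηc • meanGrad f (Q.point s r k)
      + Q.noise f s r k false (Q.point s r k) := by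
  rw [noise_eq]
  change Q.avgDual s r k - Q.ηc • ((1 / M : ℝ) • ∑ m, Q.oracle m (Q.point s r k m) (s m r k false))
    = _
  abel

lemma avgDual_succ (Q : Input E Ξ M) (f : Fin M → E → ℝ) (s : Fin M → ℕ → ℕ → Bool → Ξ) (r k : ℕ) : Q.avgDual s r (k + 1)
    = Q.avgDual s r k - Q.ηc • meanGrad f (Q.pointHalf s r k)
      + Q.noise f s r k true (Q.pointHalf s r k) := by
  rw [noise_eq]
  unfold avgDual
  simp only [clientDual_succ, sub_add_eq_sub_sub]
  rw [Finset.sum_sub_distrib, smul_sub, ← Finset.smul_sum, smul_comm]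
  abel

/-- With server step size 1 all clients restart from the average of their final duals, so
synchronization leaves the averaged dual unchanged. -/
lemma avgDual_next (hQ : IsProblem Q f β G) (r : ℕ) :
    Q.avgDual s (r + 1) 0 = Q.avgDual s r Q.K := by
  have h1 : ∀ m, Q.clientDual s m (r + 1) 0 = Q.serverDual s r + ((1 / M : ℝ) • ∑ m : Fin M,
      (Q.clientDual s m r Q.K - Q.serverDual s r)) := by
    intro m
    change Q.serverDual s r + Q.ηs • ((1 / M : ℝ) • ∑ m : Fin M,
        (Q.localDual s m r (Q.serverDual s r) Q.K - Q.serverDual s r)) = _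
    rw [hQ.ηs_eq, one_smul]; rfl
  unfold avgDual
  simp only [h1]
  rw [smul_sum_const hQ.clients_pos, Finset.sum_sub_distrib, Finset.sum_sub_distrib, smul_sub,
    smul_sub, smul_sum_const hQ.clients_pos, smul_sum_const hQ.clients_pos]
  abel

lemma gap_next (hQ : IsProblem Q f β G) (x : E) (r : ℕ) :
    Q.gap s x (r + 1) 0 = Q.gap s x r Q.K := by
  have ht : Q.time (r + 1) 0 = Q.time r Q.K := by unfold time; push_cast; ring
  unfold gap mirror
  rw [hQ.avgDual_next, hQ.dgf_next, ht]

lemma avgDual_zero (hQ : IsProblem Q f β G) : Q.avgDual s 0 0 = Q.dualBar := by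
  have h1 : ∀ m, Q.clientDual s m 0 0 = 0 := fun m => rfl
  unfold avgDual
  simp only [h1, sub_zero]
  exact smul_sum_const hQ.clients_pos _

lemma gap_nonneg (hQ : IsProblem Q f β G) {x : E} (hx : x ∈ Q.X) (hx' : Q.ψ x ≠ ⊤) (r k : ℕ) :
    0 ≤ Q.gap s x r k :=
  (hQ.isMirrorMap r k).fenchel_young _ (feasible_of_ne_top hx hx')

/-- At time zero the conjugate of `h` at `∇h(x₀)` is at most `⟨∇h(x₀), x₀⟩ - h(x₀)`, since the
Bregman divergence from `x₀` to the mirror point is nonnegative. -/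
lemma gap_zero_le (hQ : IsProblem Q f β G) {x₀ x : E} (hx₀ : x₀ ∈ Q.X)
    (h₀ : Q.dualBar = grad Q.h x₀) : Q.gap s x 0 0 ≤ bregman Q.h x₀ x := by
  have h1 := hQ.geom.bregman_strong hx₀ (hQ.mirror_mem 0 0 Q.dualBar)
  have ht : Q.time 0 0 = 0 := by simp [time]
  unfold gap conj bregman realDGF
  rw [hQ.avgDual_zero, ht, h₀] at *
  simp only [map_sub, zero_mul, add_zero] at *
  nlinarith [sq_nonneg ‖Q.mirror 0 0 (grad Q.h x₀) - x₀‖]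

/-! ### Drift and one-step inequality on sample paths with bounded gradients. -/

section Bounded

variable (hQ : IsProblem Q f β G) (hs : Q.BoundedOracle s G)
include hQ hs

lemma norm_clientDual_sub_le (m : Fin M) (r k : ℕ) :
    ‖Q.clientDual s m r k - Q.serverDual s r‖ ≤ k * (Q.ηc * G) := by
  induction k with
  | zero => simp [clientDual, localDual]
  | succ k ih =>
    rw [clientDual_succ, add_sub_right_comm]
    refine (norm_add_le _ _).trans ?_
    rw [norm_smul, Real.norm_of_nonneg hQ.ηc_pos.le]
    have := mul_le_mul_of_nonneg_left (hs r k m).2 hQ.ηc_pos.le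
    push_cast
    linarith

/-- All clients start the round from the same dual and move at most `ηG` per step, and so does their
mean. -/
lemma norm_drift_le (m : Fin M) (r k : ℕ) :
    ‖Q.dualBar - Q.clientDual s m r k - Q.avgDual s r k‖ ≤ 2 * k * (Q.ηc * G) := by
  have e : Q.dualBar - Q.clientDual s m r k - Q.avgDual s r k
      = (1 / M : ℝ) • ∑ m', (Q.clientDual s m' r k - Q.serverDual s r)
        - (Q.clientDual s m r k - Q.serverDual s r) := by
    unfold avgDual
    rw [Finset.sum_sub_distrib, Finset.sum_sub_distrib, smul_sub, smul_sub,
      smul_sum_const hQ.clients_pos, smul_sum_const hQ.clients_pos]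
    abel
  rw [e]
  have h1 := norm_average_le hQ.clients_pos fun m => hQ.norm_clientDual_sub_le hs m r k
  have h2 := hQ.norm_clientDual_sub_le hs m r k
  exact (norm_sub_le _ _).trans (by linarith)

lemma norm_point_sub_le (m : Fin M) (r k : ℕ) :
    ‖Q.point s r k m - Q.mirror r k (Q.avgDual s r k)‖ ≤ 2 * k * (Q.ηc * G) := by
  rw [hQ.point_eq]
  exact ((hQ.isMirrorMap r k).norm_sub_le _ _).trans (hQ.norm_drift_le hs m r k)

/-- The half step adds one gradient to both the client dual and the average, hence `k + 1` in place
of `k`. -/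
lemma norm_pointHalf_sub_le (m : Fin M) (r k : ℕ) :
    ‖Q.pointHalf s r k m - Q.shadowHalf s r k‖ ≤ 2 * (k + 1) * (Q.ηc * G) := by
  rw [hQ.pointHalf_eq]
  refine ((hQ.isMirrorMap r (k + 1)).norm_sub_le _ _).trans ?_
  have e : Q.dualBar - Q.clientDual s m r k - Q.ηc • Q.oracle m (Q.point s r k m) (s m r k false)
      - Q.avgDualHalf s r k = (Q.dualBar - Q.clientDual s m r k - Q.avgDual s r k)
        + Q.ηc • ((1 / M : ℝ) • ∑ m, Q.oracle m (Q.point s r k m) (s m r k false)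
          - Q.oracle m (Q.point s r k m) (s m r k false)) := by
    rw [smul_sub]
    change _ - (Q.avgDual s r k
      - Q.ηc • ((1 / M : ℝ) • ∑ m, Q.oracle m (Q.point s r k m) (s m r k false))) = _
    abel
  rw [e]
  refine (norm_add_le _ _).trans ?_
  have h1 := hQ.norm_drift_le hs m r k
  have h2 := norm_average_le hQ.clients_pos fun m => (hs r k m).1
  have h3 := (norm_sub_le ((1 / M : ℝ) • ∑ m, Q.oracle m (Q.point s r k m) (s m r k false))
    (Q.oracle m (Q.point s r k m) (s m r k false))).trans (add_le_add h2 (hs r k m).1)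
  rw [norm_smul, Real.norm_of_nonneg hQ.ηc_pos.le]
  have h4 := mul_le_mul_of_nonneg_left h3 hQ.ηc_pos.le
  linarith

lemma G_nonneg : 0 ≤ G := (norm_nonneg _).trans (hs 0 0 ⟨0, hQ.clients_pos⟩).1

/-- The error caused by evaluating gradients at two different points in an extragradient step. -/
lemma exists_directional_bound (r k : ℕ) (hk : k < Q.K) : ∃ L : ℝ,
    (∀ u ∈ Q.X, ∀ v ∈ Q.X, (Q.ηc • meanGrad f (Q.point s r k)
      - Q.ηc • meanGrad f (Q.pointHalf s r k)) (u - v) ≤ L * ‖u - v‖) ∧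
    L ^ 2 - 1 / 2 * ‖Q.shadowHalf s r k - Q.mirror r k (Q.avgDual s r k)‖ ^ 2
      ≤ Q.ηc * (20 * β ^ 2 * Q.ηc ^ 3 * Q.K ^ 2 * G ^ 2) := by
  have hη := hQ.ηc_pos
  have hG := hQ.G_nonneg hs
  have hβ := hQ.β_nonneg
  have hK : (k : ℝ) + 1 ≤ Q.K := by exact_mod_cast hk
  have hK1 : (1 : ℝ) ≤ Q.K := by
    have : (0 : ℝ) ≤ k := Nat.cast_nonneg k
    linarith
  have hdiff : ∀ w, (Q.ηc • meanGrad f (Q.point s r k) - Q.ηc • meanGrad f (Q.pointHalf s r k)) w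
      = Q.ηc * ((1 / M : ℝ) * ∑ m, (fderiv ℝ (f m) (Q.point s r k m)
        - fderiv ℝ (f m) (Q.pointHalf s r k m)) w) := by
    intro w
    simp only [meanGrad, sub_apply, smul_apply, sum_apply, smul_eq_mul, Finset.sum_sub_distrib]
    ring
  set u := ‖Q.shadowHalf s r k - Q.mirror r k (Q.avgDual s r k)‖ with hu
  have hu0 : 0 ≤ u := norm_nonneg _
  -- Small steps use smoothness and the negative square; for large steps the drift error already
  -- dominates the trivial bound from bounded gradients.
  by_cases hc : 5 * Q.K ^ 2 * (Q.ηc ^ 2 * β ^ 2) ≤ 1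
  · set d := u + (4 * Q.K - 2) * (Q.ηc * G) with hd
    have hdist : ∀ m, ‖Q.point s r k m - Q.pointHalf s r k m‖ ≤ d := by
      intro m
      have h1 := hQ.norm_point_sub_le hs m r k
      have h2 := hQ.norm_pointHalf_sub_le hs m r k
      have h3 : ‖Q.point s r k m - Q.pointHalf s r k m‖
          ≤ ‖Q.point s r k m - Q.mirror r k (Q.avgDual s r k)‖ + u
            + ‖Q.pointHalf s r k m - Q.shadowHalf s r k‖ := by
        have e : Q.point s r k m - Q.pointHalf s r k m
            = (Q.point s r k m - Q.mirror r k (Q.avgDual s r k))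
              - (Q.shadowHalf s r k - Q.mirror r k (Q.avgDual s r k))
              - (Q.pointHalf s r k m - Q.shadowHalf s r k) := by abel
        rw [e]
        exact (norm_sub_le _ _).trans (add_le_add_left (norm_sub_le _ _) _)
      -- The two drifts add up to `2k + 2(k + 1)`, and `k + 1 ≤ K` gives `4K - 2`.
      have h4 : (2 * k + 2 * (k + 1)) * (Q.ηc * G) ≤ (4 * Q.K - 2) * (Q.ηc * G) := by
        apply mul_le_mul_of_nonneg_right _ (by positivity)
        linarith
      linarith
    refine ⟨Q.ηc * (β * d), fun a ha b hb => ?_, ?_⟩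
    · rw [hdiff, mul_assoc]
      refine mul_le_mul_of_nonneg_left ?_ hη.le
      refine average_le hQ.clients_pos fun m => ?_
      refine ((hQ.smooth m).fderiv_sub_le hβ (hQ.point_mem r k m) (hQ.pointHalf_mem r k m)
        ha hb).trans ?_
      gcongr
      exact hdist m
    · have h1 := add_sq_le_of_one_le hK1 u (Q.ηc * G)
      have h2 := mul_le_mul_of_nonneg_left h1 (by positivity : 0 ≤ Q.ηc ^ 2 * β ^ 2)
      have h3 := mul_le_mul_of_nonneg_right hc (by positivity : 0 ≤ 1 / 2 * u ^ 2)
      rw [← hd] at h2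
      nlinarith
  · refine ⟨Q.ηc * (2 * G), fun a ha b hb => ?_, ?_⟩
    · rw [hdiff, mul_assoc]
      refine mul_le_mul_of_nonneg_left ?_ hη.le
      refine average_le hQ.clients_pos fun m => ?_
      refine ((le_abs_self _).trans (ContinuousLinearMap.le_opNorm (fderiv ℝ (f m) (Q.point s r k m)
        - fderiv ℝ (f m) (Q.pointHalf s r k m)) _)).trans ?_
      gcongr
      have h1 := hQ.norm_fderiv_le m _ (hQ.point_mem (s := s) r k m)
      have h2 := hQ.norm_fderiv_le m _ (hQ.pointHalf_mem (s := s) r k m)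
      exact (norm_sub_le _ _).trans (by linarith)
    -- Here `L² = 4η²G²`, and the failure of `hc` supplies the missing factor `5K²η²β² > 1`.
    · have h1 : 4 * (Q.ηc ^ 2 * G ^ 2) * 1
          ≤ 4 * (Q.ηc ^ 2 * G ^ 2) * (5 * Q.K ^ 2 * (Q.ηc ^ 2 * β ^ 2)) := by
        gcongr; exact (not_le.1 hc).le
      nlinarith [sq_nonneg u]

/-- For each client, smoothness at its own half point bounds the value at the shadow iterate from
above and convexity there bounds the value at `x` from below. The only loss is `β/2 · (2KηG)²`. -/
lemma objective_sub_le (r k : ℕ) (hk : k < Q.K) {x : E} (hx : x ∈ Q.X) :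
    realObjective f Q.ψ (Q.shadowHalf s r k) - realObjective f Q.ψ x
      ≤ meanGrad f (Q.pointHalf s r k) (Q.shadowHalf s r k)
        - meanGrad f (Q.pointHalf s r k) x + (Q.ψ (Q.shadowHalf s r k)).toReal - (Q.ψ x).toReal
        + 2 * β * Q.ηc ^ 2 * Q.K ^ 2 * G ^ 2 := by
  have hη := hQ.ηc_pos
  have hG := hQ.G_nonneg hs
  have hβ := hQ.β_nonneg
  have hK : (k : ℝ) + 1 ≤ Q.K := by exact_mod_cast hk
  have hz : Q.shadowHalf s r k ∈ Q.X := hQ.mirror_mem r (k + 1) _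
  have key : ∀ m, f m (Q.shadowHalf s r k) - f m x
      - fderiv ℝ (f m) (Q.pointHalf s r k m) (Q.shadowHalf s r k - x)
      ≤ 2 * β * Q.ηc ^ 2 * Q.K ^ 2 * G ^ 2 := by
    intro m
    have hp := hQ.pointHalf_mem (s := s) r k m
    have h1 := (hQ.smooth m).smooth _ hz _ hp
    have h2 := (hQ.smooth m).gradient_inequality hx hp
    have h3 := hQ.norm_pointHalf_sub_le hs m r k
    rw [norm_sub_rev] at h3
    have h4 : ‖Q.shadowHalf s r k - Q.pointHalf s r k m‖ ^ 2 ≤ (2 * Q.K * (Q.ηc * G)) ^ 2 := by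
      gcongr
      refine h3.trans ?_
      gcongr
    have h5 := mul_le_mul_of_nonneg_left h4 (div_nonneg hβ zero_le_two)
    simp only [map_sub] at *
    linarith
  have h := average_le hQ.clients_pos key
  unfold realObjective meanGrad
  simp only [smul_apply, sum_apply, smul_eq_mul, Finset.sum_sub_distrib, map_sub] at *
  linarith

/-- The change of the potential in one local step, on every sample path. -/
lemma gap_succ_le (r k : ℕ) (hk : k < Q.K) {x : E} (hx : x ∈ Q.X) :
    Q.gap s x r (k + 1)
        + Q.ηc * (realObjective f Q.ψ (Q.shadowHalf s r k) - realObjective f Q.ψ x)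
      ≤ Q.gap s x r k + Q.ηc * (20 * β ^ 2 * Q.ηc ^ 3 * Q.K ^ 2 * G ^ 2
          + 2 * β * Q.ηc ^ 2 * Q.K ^ 2 * G ^ 2)
        + Q.noise f s r k true (Q.pointHalf s r k) (Q.mirror r (k + 1)
            (Q.avgDual s r k - Q.ηc • meanGrad f (Q.pointHalf s r k)
              + Q.noise f s r k true (Q.pointHalf s r k)))
        + Q.noise f s r k false (Q.point s r k) (Q.mirror r (k + 1)
            (Q.avgDual s r k - Q.ηc • meanGrad f (Q.point s r k)
              + Q.noise f s r k false (Q.point s r k)))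
        - Q.noise f s r k false (Q.point s r k) (Q.mirror r (k + 1)
            (Q.avgDual s r k - Q.ηc • meanGrad f (Q.point s r k)))
        - Q.noise f s r k true (Q.pointHalf s r k) x := by
  obtain ⟨L, hL, hL'⟩ := hQ.exists_directional_bound hs r k hk
  have hdgf : realDGF Q.h Q.ψ (Q.time r (k + 1))
      = fun y => realDGF Q.h Q.ψ (Q.time r k) y + Q.ηc * (Q.ψ y).toReal := by
    funext y; rw [time_succ]; unfold realDGF; ring
  have hT' := hQ.isMirrorMap r (k + 1)
  have hsub : feasible Q.X Q.ψ (Q.time r (k + 1)) ⊆ feasible Q.X Q.ψ (Q.time r k) := by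
    intro y hy
    refine feasible_of_ne_top hy.1 (hy.2.resolve_left ?_)
    have h1 := hQ.time_nonneg r k
    have h2 := hQ.ηc_pos
    have h3 := time_succ Q r k
    linarith
  -- Advancing one local step adds `η ψ` to the function, which is the form that
  -- `extragradient_step` expects.
  rw [hdgf] at hT'
  have h1 := (hQ.isMirrorMap r k).extragradient_step hT' hsub (Q.avgDual s r k)
    (meanGrad f (Q.point s r k)) (meanGrad f (Q.pointHalf s r k))
    (Q.noise f s r k false (Q.point s r k)) (Q.noise f s r k true (Q.pointHalf s r k))
    (fun u hu v hv => hL u hu.1 v hv.1)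
  have hz : Q.mirror r (k + 1) (Q.avgDual s r k - Q.ηc • meanGrad f (Q.point s r k)
      + Q.noise f s r k false (Q.point s r k)) = Q.shadowHalf s r k := by
    rw [← avgDualHalf_eq Q f]; rfl
  have h2 := mul_le_mul_of_nonneg_left (hQ.objective_sub_le hs r k hk hx) hQ.ηc_pos.le
  have h3 : Q.avgDual s r (k + 1) x = Q.avgDual s r k x
      - Q.ηc * meanGrad f (Q.pointHalf s r k) x + Q.noise f s r k true (Q.pointHalf s r k) x := by
    rw [avgDual_succ Q f]; simp
  unfold gap
  rw [h3, hdgf, avgDual_succ Q f]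
  rw [hz] at h1 ⊢
  linarith

end Bounded

end IsProblem

end Pathwise

/-! ### Expected suboptimality -/

section Stochastic

variable {E Ξ Ω : Type*} [NormedAddCommGroup E] [NormedSpace ℝ E] [FiniteDimensional ℝ E]
  [MeasurableSpace E] [BorelSpace E] [MeasurableSpace Ξ] [MeasurableSpace Ω] {M : ℕ}

/-- A problem instance with unbiased, bounded stochastic gradients and independent samples. -/
structure IsStochasticProblem (P : Measure Ω) (Q : Input E Ξ M) (f : Fin M → E → ℝ)
    (D : Fin M → Measure Ξ) (ξ : Fin M → ℕ → ℕ → Bool → Ω → Ξ) (β σ G : ℝ) : Prop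
    extends IsProblem Q f β G where
  K_pos : 0 < Q.K
  oracle : ∀ m, IsOracle Q.X (D m) (Q.oracle m) (fderiv ℝ (f m)) σ G
  measurable_sample : ∀ m r k b, Measurable (ξ m r k b)
  law : ∀ m r k b, P.map (ξ m r k b) = D m
  indep : iIndepFun (fun i : Fin M × ℕ × ℕ × Bool => ξ i.1 i.2.1 i.2.2.1 i.2.2.2) P

/-- The samples drawn before local step `k` of round `r`. -/
def past (M r k : ℕ) : Set (Fin M × ℕ × ℕ × Bool) :=
  {i | i.2.1 < r ∨ (i.2.1 = r ∧ i.2.2.1 < k)}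

/-- The samples drawn before the second half of local step `k` of round `r`. -/
def pastHalf (M r k : ℕ) : Set (Fin M × ℕ × ℕ × Bool) :=
  {i | i ∈ past M r k ∨ (i.2.1 = r ∧ i.2.2.1 = k ∧ i.2.2.2 = false)}

/-- The samples as a family over a single index. -/
def family (ξ : Fin M → ℕ → ℕ → Bool → Ω → Ξ) (i : Fin M × ℕ × ℕ × Bool) : Ω → Ξ :=
  ξ i.1 i.2.1 i.2.2.1 i.2.2.2

/-- The sample path at `ω`. -/
def path (ξ : Fin M → ℕ → ℕ → Bool → Ω → Ξ) (ω : Ω) : Fin M → ℕ → ℕ → Bool → Ξ :=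
  fun m r k b => ξ m r k b ω

lemma past_subset_pastHalf {r k : ℕ} : past M r k ⊆ pastHalf M r k := fun _ h => Or.inl h

lemma pastHalf_subset_succ {r k : ℕ} : pastHalf M r k ⊆ past M r (k + 1) := by
  rintro ⟨m, r', k', b⟩ h
  simp only [pastHalf, past, mem_ofPred_eq] at h ⊢
  omega

lemma past_subset_next {r k : ℕ} : past M r k ⊆ past M (r + 1) 0 := by
  rintro ⟨m, r', k', b⟩ h
  simp only [past, mem_ofPred_eq] at h ⊢
  omega

namespace IsStochasticProblem

open Input

variable {P : Measure Ω} [IsProbabilityMeasure P] {Q : Input E Ξ M} {f : Fin M → E → ℝ}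
  {D : Fin M → Measure Ξ} {ξ : Fin M → ℕ → ℕ → Bool → Ω → Ξ} {β σ G : ℝ}

lemma measurable_pointHalf_of (hQ : IsStochasticProblem P Q f D ξ β σ G) {r k : ℕ} {m : Fin M}
    (h : Measurable[sampleAlg (family ξ) (past M r k)] fun ω => Q.clientDual (path ξ ω) m r k) :
    Measurable[sampleAlg (family ξ) (past M r k)] (fun ω => Q.point (path ξ ω) r k m) ∧
    Measurable[sampleAlg (family ξ) (pastHalf M r k)] (fun ω => Q.pointHalf (path ξ ω) r k m) := by
  have h1 : Measurable[sampleAlg (family ξ) (past M r k)] fun ω => Q.point (path ξ ω) r k m := by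
    simp only [hQ.point_eq]
    exact (hQ.isMirrorMap r k).continuous.measurable.comp (measurable_const.sub h)
  refine ⟨h1, ?_⟩
  simp only [hQ.pointHalf_eq]
  refine (hQ.isMirrorMap r (k + 1)).continuous.measurable.comp ?_
  have hle := sampleAlg_mono (ξ := family ξ) (past_subset_pastHalf (M := M) (r := r) (k := k))
  have hs : Measurable[sampleAlg (family ξ) (pastHalf M r k)] fun ω => path ξ ω m r k false :=
    measurable_sampleAlg (ξ := family ξ) (i := (m, r, k, false)) (Or.inr ⟨rfl, rfl, rfl⟩)
  exact (measurable_const.sub (h.mono hle le_rfl)).sub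
    (((hQ.oracle m).measurable_sample (h1.mono hle le_rfl) hs).const_smul Q.ηc)

lemma measurable_localDual (hQ : IsStochasticProblem P Q f D ξ β σ G) {r : ℕ}
    (h : Measurable[sampleAlg (family ξ) (past M r 0)] fun ω => Q.serverDual (path ξ ω) r)
    (m : Fin M) (k : ℕ) :
    Measurable[sampleAlg (family ξ) (past M r k)] fun ω => Q.clientDual (path ξ ω) m r k := by
  induction k with
  | zero => exact h
  | succ k ih =>
    simp only [IsProblem.clientDual_succ]
    have hle := sampleAlg_mono (ξ := family ξ) (pastHalf_subset_succ (M := M) (r := r) (k := k))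
    have hle' := sampleAlg_mono (ξ := family ξ) (past_subset_pastHalf (M := M) (r := r) (k := k))
    have hs : Measurable[sampleAlg (family ξ) (past M r (k + 1))] fun ω => path ξ ω m r k true :=
      measurable_sampleAlg (ξ := family ξ) (i := (m, r, k, true)) (Or.inr ⟨rfl, Nat.lt_succ_self k⟩)
    exact (ih.mono (hle'.trans hle) le_rfl).add (((hQ.oracle m).measurable_sample
      ((hQ.measurable_pointHalf_of ih).2.mono hle le_rfl) hs).const_smul Q.ηc)

lemma measurable_serverDual (hQ : IsStochasticProblem P Q f D ξ β σ G) (r : ℕ) :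
    Measurable[sampleAlg (family ξ) (past M r 0)] fun ω => Q.serverDual (path ξ ω) r := by
  induction r with
  | zero => exact measurable_const
  | succ r ih =>
    have hle := sampleAlg_mono (ξ := family ξ) (past_subset_next (M := M) (r := r) (k := Q.K))
    have hle' := sampleAlg_mono (ξ := family ξ) (past_subset_next (M := M) (r := r) (k := 0))
    have h1 := ih.mono hle' le_rfl
    refine h1.add (Measurable.const_smul (Measurable.const_smul (Finset.measurable_fun_sum _
      fun m _ => Measurable.sub ?_ h1) (1 / M : ℝ)) Q.ηs)
    exact (hQ.measurable_localDual ih m Q.K).mono hle le_rfl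

lemma measurable_clientDual (hQ : IsStochasticProblem P Q f D ξ β σ G) (m : Fin M) (r k : ℕ) :
    Measurable[sampleAlg (family ξ) (past M r k)] fun ω => Q.clientDual (path ξ ω) m r k :=
  hQ.measurable_localDual (hQ.measurable_serverDual r) m k

lemma measurable_avgDual (hQ : IsStochasticProblem P Q f D ξ β σ G) (r k : ℕ) :
    Measurable[sampleAlg (family ξ) (past M r k)] fun ω => Q.avgDual (path ξ ω) r k :=
  Measurable.const_smul (Finset.measurable_fun_sum _ fun m _ =>
    measurable_const.sub (hQ.measurable_clientDual m r k)) (1 / M : ℝ)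

lemma measurable_family (hQ : IsStochasticProblem P Q f D ξ β σ G) (i : Fin M × ℕ × ℕ × Bool) :
    Measurable (family ξ i) := hQ.measurable_sample _ _ _ _

lemma isQuery (hQ : IsStochasticProblem P Q f D ξ β σ G) (r k : ℕ) :
    IsQuery P (family ξ) (fun m => (m, r, k, false)) (past M r k) Q.X D Q.oracle
      (fun m => fderiv ℝ (f m)) σ G (fun m ω => Q.point (path ξ ω) r k m) where
  measurable_sample := hQ.measurable_family
  indep := hQ.indep
  law m := hQ.law m r k false
  injective m m' h := congrArg Prod.fst h
  fresh m := by simp [past]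
  oracle := hQ.oracle
  measurable m := (hQ.measurable_pointHalf_of (hQ.measurable_clientDual m r k)).1
  mem m ω := hQ.point_mem r k m

lemma isQuery_half (hQ : IsStochasticProblem P Q f D ξ β σ G) (r k : ℕ) :
    IsQuery P (family ξ) (fun m => (m, r, k, true)) (pastHalf M r k) Q.X D Q.oracle
      (fun m => fderiv ℝ (f m)) σ G (fun m ω => Q.pointHalf (path ξ ω) r k m) where
  measurable_sample := hQ.measurable_family
  indep := hQ.indep
  law m := hQ.law m r k true
  injective m m' h := congrArg Prod.fst h
  fresh m := by simp [pastHalf, past]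
  oracle := hQ.oracle
  measurable m := (hQ.measurable_pointHalf_of (hQ.measurable_clientDual m r k)).2
  mem m ω := hQ.pointHalf_mem r k m

lemma ae_boundedOracle (hQ : IsStochasticProblem P Q f D ξ β σ G) :
    ∀ᵐ ω ∂P, Q.BoundedOracle (path ξ ω) G := by
  unfold BoundedOracle
  simp only [ae_all_iff]
  intro r k m
  filter_upwards [(hQ.isQuery r k).ae_norm_le m, (hQ.isQuery_half r k).ae_norm_le m] with ω h1 h2
  exact ⟨h1, h2⟩

lemma measurable_meanGrad (hQ : IsStochasticProblem P Q f D ξ β σ G) {S}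
    {x : Fin M → Ω → E} (hx : ∀ m, Measurable[sampleAlg (family ξ) S] (x m))
    (hxX : ∀ m ω, x m ω ∈ Q.X) :
    Measurable[sampleAlg (family ξ) S] fun ω => meanGrad f fun m => x m ω :=
  Measurable.const_smul (Finset.measurable_fun_sum _ fun m _ => by
    have := (hQ.isQuery 0 0).isProbabilityMeasure m
    exact (hQ.oracle m).measurable_grad (hx m) (hxX m)) (1 / M : ℝ)

lemma exists_norm_le (hQ : IsStochasticProblem P Q f D ξ β σ G) : ∃ C : ℝ, ∀ x ∈ Q.X, ‖x‖ ≤ C :=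
  hQ.geom.compact.exists_bound_of_continuousOn (f := id) continuousOn_id

/-- The noise terms in the one-step inequality have small expectation. -/
lemma noise_terms (hQ : IsStochasticProblem P Q f D ξ β σ G) (r k : ℕ) {x : E} (hx : x ∈ Q.X) :
    ∃ N : Ω → ℝ, Integrable N P ∧ ∫ ω, N ω ∂P ≤ 2 * (Q.ηc ^ 2 * σ ^ 2 / M) ∧
      (∀ ω, N ω = Q.noise f (path ξ ω) r k true (Q.pointHalf (path ξ ω) r k) (Q.mirror r (k + 1)
            (Q.avgDual (path ξ ω) r k - Q.ηc • meanGrad f (Q.pointHalf (path ξ ω) r k)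
              + Q.noise f (path ξ ω) r k true (Q.pointHalf (path ξ ω) r k)))
        + Q.noise f (path ξ ω) r k false (Q.point (path ξ ω) r k) (Q.mirror r (k + 1)
            (Q.avgDual (path ξ ω) r k - Q.ηc • meanGrad f (Q.point (path ξ ω) r k)
              + Q.noise f (path ξ ω) r k false (Q.point (path ξ ω) r k)))
        - Q.noise f (path ξ ω) r k false (Q.point (path ξ ω) r k) (Q.mirror r (k + 1)
            (Q.avgDual (path ξ ω) r k - Q.ηc • meanGrad f (Q.point (path ξ ω) r k)))
        - Q.noise f (path ξ ω) r k true (Q.pointHalf (path ξ ω) r k) x) := by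
  obtain ⟨C, hC⟩ := hQ.exists_norm_le
  have hq := hQ.isQuery r k
  have hq' := hQ.isQuery_half r k
  have hT := hQ.isMirrorMap r (k + 1)
  have hTC : ∀ a, ‖Q.mirror r (k + 1) a‖ ≤ C := fun a => hC _ (hQ.mirror_mem _ _ _)
  have ha : Measurable[sampleAlg (family ξ) (past M r k)] fun ω =>
      Q.avgDual (path ξ ω) r k - Q.ηc • meanGrad f (Q.point (path ξ ω) r k) :=
    (hQ.measurable_avgDual r k).sub
      ((hQ.measurable_meanGrad hq.measurable hq.mem).const_smul Q.ηc)
  have hb : Measurable[sampleAlg (family ξ) (pastHalf M r k)] fun ω =>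
      Q.avgDual (path ξ ω) r k - Q.ηc • meanGrad f (Q.pointHalf (path ξ ω) r k) :=
    ((hQ.measurable_avgDual r k).mono (sampleAlg_mono past_subset_pastHalf) le_rfl).sub
      ((hQ.measurable_meanGrad hq'.measurable hq'.mem).const_smul Q.ηc)
  -- Two noises are paired with points that depend on them, each costing `η²σ²/M` by leave-one-out.
  -- The other two are paired with points fixed before the sample is drawn and vanish in
  -- expectation.
  have h1 := hq'.integral_queryNoise_apply_le hQ.clients_pos Q.ηc hT.norm_sub_le hTC hb
  have h2 := hq.integral_queryNoise_apply_le hQ.clients_pos Q.ηc hT.norm_sub_le hTC ha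
  have hw := hT.continuous.measurable.comp ha
  have h3 := hq.integral_queryNoise_apply Q.ηc hw fun ω => hTC _
  have h3i := hq.integrable_queryNoise_apply Q.ηc
    (hw.mono (sampleAlg_le hQ.measurable_family) le_rfl) fun ω => hTC _
  have h4 := hq'.integral_queryNoise_apply Q.ηc (w := fun _ => x) measurable_const
    fun ω => hC x hx
  have h4i := hq'.integrable_queryNoise_apply Q.ηc (w := fun _ => x) measurable_const
    fun ω => hC x hx
  refine ⟨_, ((h1.1.add h2.1).sub h3i).sub h4i, ?_, fun ω => rfl⟩
  rw [integral_sub' ((h1.1.add h2.1).sub h3i) h4i, integral_sub' (h1.1.add h2.1) h3i,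
    integral_add' h1.1 h2.1, h3, h4]
  linarith [h1.2, h2.2]

end IsStochasticProblem

end Stochastic

/-! ### Integrability and the expected bound for a fixed step size -/

section RealObjective

variable {E : Type*} [NormedAddCommGroup E] [NormedSpace ℝ E] {M : ℕ}

lemma objective_eq_coe {f : Fin M → E → ℝ} {ψ : E → EReal} {x : E} (h : ψ x ≠ ⊤) (h' : ψ x ≠ ⊥) :
    objective f ψ x = (realObjective f ψ x : EReal) := by
  unfold objective realObjective
  rw [EReal.coe_add, EReal.coe_toReal h h']

lemma objective_ne_top_iff {f : Fin M → E → ℝ} {ψ : E → EReal} {x : E} :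
    objective f ψ x ≠ ⊤ ↔ ψ x ≠ ⊤ := by
  unfold objective
  rw [EReal.add_ne_top_iff_ne_top_right (EReal.coe_ne_bot _) (EReal.coe_ne_top _)]

end RealObjective

namespace IsProblem

open Input

variable {E Ξ : Type*} [NormedAddCommGroup E] [NormedSpace ℝ E] {M : ℕ} {Q : Input E Ξ M}
  {f : Fin M → E → ℝ} {β G : ℝ} {s : Fin M → ℕ → ℕ → Bool → Ξ}

lemma norm_serverDual_le (hQ : IsProblem Q f β G) (hs : Q.BoundedOracle s G) (r : ℕ) :
    ‖Q.serverDual s r‖ ≤ r * (Q.K * (Q.ηc * G)) := by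
  induction r with
  | zero => simp [serverDual]
  | succ r ih =>
    have h1 := norm_average_le hQ.clients_pos fun m => hQ.norm_clientDual_sub_le hs m r Q.K
    have e : Q.serverDual s (r + 1) = Q.serverDual s r + ((1 / M : ℝ) • ∑ m : Fin M,
        (Q.clientDual s m r Q.K - Q.serverDual s r)) := by
      change Q.serverDual s r + Q.ηs • ((1 / M : ℝ) • ∑ m : Fin M,
        (Q.localDual s m r (Q.serverDual s r) Q.K - Q.serverDual s r)) = _
      rw [hQ.ηs_eq, one_smul]; rfl
    rw [e]
    refine (norm_add_le _ _).trans ?_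
    push_cast
    linarith

lemma norm_avgDual_le (hQ : IsProblem Q f β G) (hs : Q.BoundedOracle s G) (r k : ℕ) :
    ‖Q.avgDual s r k‖ ≤ ‖Q.dualBar‖ + (k * (Q.ηc * G) + r * (Q.K * (Q.ηc * G))) := by
  refine norm_average_le hQ.clients_pos fun m => (norm_sub_le _ _).trans ?_
  have h1 := hQ.norm_clientDual_sub_le hs m r k
  have h2 := hQ.norm_serverDual_le hs r
  have h3 := norm_le_norm_add_norm_sub' (Q.clientDual s m r k) (Q.serverDual s r)
  linarith

lemma norm_avgDualHalf_le (hQ : IsProblem Q f β G) (hs : Q.BoundedOracle s G) (r k : ℕ) :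
    ‖Q.avgDualHalf s r k‖
      ≤ ‖Q.dualBar‖ + (k * (Q.ηc * G) + r * (Q.K * (Q.ηc * G))) + Q.ηc * G := by
  refine (norm_sub_le _ _).trans (add_le_add (hQ.norm_avgDual_le hs r k) ?_)
  rw [norm_smul, Real.norm_of_nonneg hQ.ηc_pos.le]
  exact mul_le_mul_of_nonneg_left (norm_average_le hQ.clients_pos fun m => (hs r k m).1)
    hQ.ηc_pos.le

lemma shadowHalf_mem (hQ : IsProblem Q f β G) (r k : ℕ) : Q.shadowHalf s r k ∈ Q.X :=
  hQ.mirror_mem r (k + 1) _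

lemma shadowHalf_ne_top (hQ : IsProblem Q f β G) (r k : ℕ) : Q.ψ (Q.shadowHalf s r k) ≠ ⊤ :=
  hQ.mirror_succ_ne_top r k _

lemma exists_abs_objective_le (hQ : IsProblem Q f β G) :
    ∃ C : ℝ, ∀ x ∈ Q.X, |(1 / M : ℝ) * ∑ m, f m x| ≤ C := by
  have hc : ContinuousOn (fun x => (1 / M : ℝ) * ∑ m, f m x) Q.X :=
    continuousOn_const.mul (continuousOn_finsetSum _ fun m _ => (hQ.smooth m).continuousOn)
  exact hQ.geom.compact.exists_bound_of_continuousOn hc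

/-- The regularizer is bounded along the sequence of shadow iterates, uniformly in the samples. -/
lemma exists_reg_shadowHalf_le (hQ : IsProblem Q f β G) (r k : ℕ) :
    ∃ C : ℝ, ∀ s : Fin M → ℕ → ℕ → Bool → Ξ, Q.BoundedOracle s G →
      (Q.ψ (Q.shadowHalf s r k)).toReal ≤ C := by
  obtain ⟨C₁, hC₁⟩ := hQ.geom.compact.exists_bound_of_continuousOn hQ.geom.continuousOn
  obtain ⟨C₂, hC₂⟩ : ∃ C : ℝ, ∀ x ∈ Q.X, ‖x‖ ≤ C :=
    hQ.geom.compact.exists_bound_of_continuousOn (f := id) continuousOn_id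
  obtain ⟨x, hx, hfin⟩ := hQ.geom.exists_finite
  set c := ‖Q.dualBar‖ + (k * (Q.ηc * G) + r * (Q.K * (Q.ηc * G))) + Q.ηc * G
  have hτ : 0 < Q.time r (k + 1) := by
    have h1 := hQ.time_nonneg r k
    have h2 := hQ.ηc_pos
    rw [time_succ]; linarith
  refine ⟨(Q.ψ x).toReal + (2 * C₁ + c * (2 * C₂)) / Q.time r (k + 1), fun s hs => ?_⟩
  have hz := hQ.shadowHalf_mem (s := s) r k
  -- Minimality against a point of finite `ψ` bounds `τ ψ` at the shadow iterate, since `h`, the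
  -- points and the dual are bounded; the weight `τ` is positive and can be divided out.
  have h1 := (hQ.isMirrorMap r (k + 1)).growth (Q.avgDualHalf s r k) x
    (feasible_of_ne_top hx hfin)
  change realDGF _ _ _ (Q.shadowHalf s r k) - Q.avgDualHalf s r k (Q.shadowHalf s r k)
    + 1 / 2 * ‖x - Q.shadowHalf s r k‖ ^ 2 ≤ _ at h1
  unfold realDGF at h1
  have h2 := abs_le.1 (hC₁ x hx)
  have h3 := abs_le.1 (hC₁ _ hz)
  have h4 : Q.avgDualHalf s r k (Q.shadowHalf s r k - x) ≤ c * (2 * C₂) := by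
    refine (le_abs_self _).trans (((Q.avgDualHalf s r k).le_opNorm _).trans ?_)
    have h5 := hQ.norm_avgDualHalf_le hs r k
    refine mul_le_mul h5 ?_ (norm_nonneg _) ((norm_nonneg _).trans h5)
    have := hC₂ x hx
    have := hC₂ _ hz
    exact (norm_sub_le _ _).trans (by linarith)
  rw [map_sub] at h4
  have h6 := sq_nonneg ‖x - Q.shadowHalf s r k‖
  have h7 : Q.time r (k + 1) * (Q.ψ (Q.shadowHalf s r k)).toReal
      ≤ Q.time r (k + 1) * ((Q.ψ x).toReal + (2 * C₁ + c * (2 * C₂)) / Q.time r (k + 1)) := by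
    rw [mul_add, mul_div_cancel₀ _ hτ.ne']
    linarith
  exact le_of_mul_le_mul_left h7 hτ

lemma exists_le_realObjective (hQ : IsProblem Q f β G) :
    ∃ c : ℝ, ∀ x ∈ Q.X, Q.ψ x ≠ ⊤ → c ≤ realObjective f Q.ψ x := by
  obtain ⟨C, hC⟩ := hQ.exists_abs_objective_le
  obtain ⟨c, hc⟩ := hQ.geom.reg_bddBelow
  refine ⟨-C + c, fun x hx hx' => add_le_add (abs_le.1 (hC x hx)).1 (hc x hx hx')⟩

lemma realObjective_convexOn (hQ : IsProblem Q f β G) :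
    ConvexOn ℝ (Q.X ∩ effDom Q.ψ) (realObjective f Q.ψ) := by
  have hc : Convex ℝ (Q.X ∩ effDom Q.ψ) := hQ.geom.convex.inter hQ.geom.reg.convexOn.1
  have h1 : ConvexOn ℝ (Q.X ∩ effDom Q.ψ) (fun x => (1 / M : ℝ) * ∑ m, f m x) := by
    refine ⟨hc, fun x hx y hy a b ha hb hab => ?_⟩
    have := Finset.sum_le_sum fun m (_ : m ∈ Finset.univ) =>
      (hQ.smooth m).convexOn.2 hx.1 hy.1 ha hb hab
    have := mul_le_mul_of_nonneg_left this (by positivity : (0 : ℝ) ≤ 1 / M)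
    simp only [smul_eq_mul, Finset.sum_add_distrib, ← Finset.mul_sum] at *
    linarith
  exact h1.add (hQ.geom.reg.convexOn.subset inter_subset_right hc)

/-! ### The ergodic average and Jensen's inequality. -/

section Output

variable (hQ : IsProblem Q f β G) (hK : 0 < Q.K) {R : ℕ} (hR : 0 < R)
include hQ hK hR

lemma output_eq : Q.output s R = ∑ p ∈ Finset.range R ×ˢ Finset.range Q.K,
    (1 / (R * Q.K) : ℝ) • Q.shadowHalf s p.1 p.2 := by
  unfold output
  rw [← Finset.smul_sum, Finset.sum_product]

lemma sum_weights : ∑ _p ∈ Finset.range R ×ˢ Finset.range Q.K, (1 / (R * Q.K) : ℝ) = 1 := by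
  have h1 : (R : ℝ) ≠ 0 := by exact_mod_cast hR.ne'
  have h2 : (Q.K : ℝ) ≠ 0 := by exact_mod_cast hK.ne'
  rw [Finset.sum_const, Finset.card_product, Finset.card_range, Finset.card_range, nsmul_eq_mul]
  push_cast
  field_simp

lemma output_mem : Q.output s R ∈ Q.X ∩ effDom Q.ψ := by
  rw [hQ.output_eq hK hR]
  exact hQ.realObjective_convexOn.1.sum_mem (fun _ _ => by positivity) (hQ.sum_weights hK hR)
    fun p _ => ⟨hQ.shadowHalf_mem _ _, hQ.shadowHalf_ne_top _ _⟩

lemma realObjective_output_le : realObjective f Q.ψ (Q.output s R)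
    ≤ (1 / (R * Q.K) : ℝ) * ∑ r ∈ Finset.range R, ∑ k ∈ Finset.range Q.K,
        realObjective f Q.ψ (Q.shadowHalf s r k) := by
  rw [hQ.output_eq hK hR, ← Finset.sum_product', Finset.mul_sum]
  exact hQ.realObjective_convexOn.map_sum_le (fun _ _ => by positivity) (hQ.sum_weights hK hR)
    fun p _ => ⟨hQ.shadowHalf_mem _ _, hQ.shadowHalf_ne_top _ _⟩

end Output

end IsProblem

namespace IsStochasticProblem

open Input

variable {E Ξ Ω : Type*} [NormedAddCommGroup E] [NormedSpace ℝ E] [FiniteDimensional ℝ E]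
  [MeasurableSpace E] [BorelSpace E] [MeasurableSpace Ξ] [MeasurableSpace Ω] {M : ℕ}
  {P : Measure Ω} [IsProbabilityMeasure P] {Q : Input E Ξ M} {f : Fin M → E → ℝ}
  {D : Fin M → Measure Ξ} {ξ : Fin M → ℕ → ℕ → Bool → Ω → Ξ} {β σ G : ℝ}

lemma measurable_realObjective (hQ : IsStochasticProblem P Q f D ξ β σ G) {z : Ω → E}
    (hz : Measurable z) (hzX : ∀ ω, z ω ∈ Q.X) :
    Measurable fun ω => realObjective f Q.ψ (z ω) := by
  have hf : ∀ m, Measurable fun ω => f m (z ω) := fun m =>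
    (continuousOn_iff_continuous_domRestrict.1 (hQ.smooth m).continuousOn).measurable.comp
      (hz.subtype_mk (h := hzX))
  exact ((Finset.measurable_fun_sum _ fun m _ => hf m).const_mul _).add
    (hQ.geom.reg.closed.measurable.comp hz).ereal_toReal

lemma measurable_shadowHalf (hQ : IsStochasticProblem P Q f D ξ β σ G) (r k : ℕ) :
    Measurable fun ω => Q.shadowHalf (path ξ ω) r k := by
  have h := (hQ.isMirrorMap r (k + 1)).continuous.measurable.comp
    ((((hQ.measurable_avgDual r k).mono (sampleAlg_mono (past_subset_pastHalf (M := M))) le_rfl).sub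
      ((hQ.measurable_meanGrad (fun m => (hQ.isQuery r k).measurable m)
        (hQ.isQuery r k).mem).mono (sampleAlg_mono (past_subset_pastHalf (M := M))) le_rfl
          |>.const_smul Q.ηc)).add ((hQ.isQuery r k).measurable_queryNoise Q.ηc
            (past_subset_pastHalf (M := M)) fun m => Or.inr ⟨rfl, rfl, rfl⟩))
  have e : (fun ω => Q.shadowHalf (path ξ ω) r k) = fun ω => Q.mirror r (k + 1)
      (Q.avgDual (path ξ ω) r k - Q.ηc • meanGrad f (Q.point (path ξ ω) r k)
        + Q.noise f (path ξ ω) r k false (Q.point (path ξ ω) r k)) := by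
    funext ω
    rw [← IsProblem.avgDualHalf_eq Q f]; rfl
  rw [e]
  exact h.mono (sampleAlg_le hQ.measurable_family) le_rfl

lemma integrable_shadowHalf (hQ : IsStochasticProblem P Q f D ξ β σ G) (r k : ℕ) :
    Integrable (fun ω => realObjective f Q.ψ (Q.shadowHalf (path ξ ω) r k)) P := by
  obtain ⟨c, hc⟩ := hQ.exists_le_realObjective
  obtain ⟨C, hC⟩ := hQ.exists_reg_shadowHalf_le r k
  obtain ⟨C', hC'⟩ := hQ.exists_abs_objective_le
  refine integrable_of_le_of_le (hQ.measurable_realObjective (hQ.measurable_shadowHalf r k)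
    fun ω => hQ.shadowHalf_mem r k).aestronglyMeasurable
    (ae_of_all _ fun ω => hc _ (hQ.shadowHalf_mem r k) (hQ.shadowHalf_ne_top r k)) ?_
    (integrable_const c) (integrable_const (C' + C))
  filter_upwards [hQ.ae_boundedOracle] with ω hω
  exact add_le_add (abs_le.1 (hC' _ (hQ.shadowHalf_mem r k))).2 (hC _ hω)

/-- The potential is a continuous function of the averaged dual, which almost surely stays in a
fixed ball, compact in finite dimension. -/
lemma integrable_gap (hQ : IsStochasticProblem P Q f D ξ β σ G) (x : E) (r k : ℕ) :
    Integrable (fun ω => Q.gap (path ξ ω) x r k) P := by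
  obtain ⟨C, hC⟩ := hQ.exists_norm_le
  have hT := hQ.isMirrorMap r k
  have hconj := hT.continuous_conj fun u hu => hC u hu.1
  have hm : Measurable fun ω => Q.avgDual (path ξ ω) r k :=
    (hQ.measurable_avgDual r k).mono (sampleAlg_le hQ.measurable_family) le_rfl
  set c := ‖Q.dualBar‖ + (k * (Q.ηc * G) + r * (Q.K * (Q.ηc * G)))
  have hcont : Continuous fun a : E →L[ℝ] ℝ =>
      conj (realDGF Q.h Q.ψ (Q.time r k)) (Q.mirror r k) a - a x
        + realDGF Q.h Q.ψ (Q.time r k) x := by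
    fun_prop
  obtain ⟨B, hB⟩ := (isCompact_closedBall (0 : E →L[ℝ] ℝ) c).exists_bound_of_continuousOn
    hcont.continuousOn
  refine Integrable.of_bound (hcont.measurable.comp hm).aestronglyMeasurable B ?_
  filter_upwards [hQ.ae_boundedOracle] with ω hω
  exact hB _ (by simpa using hQ.norm_avgDual_le hω r k)

/-- The expected suboptimality of the shadow iterate at one local step. -/
lemma integral_step (hQ : IsStochasticProblem P Q f D ξ β σ G) (r k : ℕ) (hk : k < Q.K) {x : E}
    (hx : x ∈ Q.X) :
    Q.ηc * ∫ ω, (realObjective f Q.ψ (Q.shadowHalf (path ξ ω) r k) - realObjective f Q.ψ x) ∂P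
      ≤ ∫ ω, Q.gap (path ξ ω) x r k ∂P - ∫ ω, Q.gap (path ξ ω) x r (k + 1) ∂P
        + Q.ηc * (20 * β ^ 2 * Q.ηc ^ 3 * Q.K ^ 2 * G ^ 2 + 5 * σ ^ 2 * Q.ηc / M
          + 2 * β * Q.ηc ^ 2 * Q.K ^ 2 * G ^ 2) := by
  obtain ⟨N, hN, hN', hNeq⟩ := hQ.noise_terms r k hx
  have hg := hQ.integrable_gap x r k
  have hg' := hQ.integrable_gap x r (k + 1)
  have hφ : Integrable (fun ω => realObjective f Q.ψ (Q.shadowHalf (path ξ ω) r k)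
      - realObjective f Q.ψ x) P := (hQ.integrable_shadowHalf r k).sub (integrable_const _)
  set c := Q.ηc * (20 * β ^ 2 * Q.ηc ^ 3 * Q.K ^ 2 * G ^ 2 + 2 * β * Q.ηc ^ 2 * Q.K ^ 2 * G ^ 2)
    with hcdef
  have hle : ∀ᵐ ω ∂P, Q.ηc * (realObjective f Q.ψ (Q.shadowHalf (path ξ ω) r k)
      - realObjective f Q.ψ x)
      ≤ Q.gap (path ξ ω) x r k - Q.gap (path ξ ω) x r (k + 1) + N ω + c := by
    filter_upwards [hQ.ae_boundedOracle] with ω hω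
    have := hQ.gap_succ_le hω r k hk hx
    rw [hNeq]
    linarith
  have h1 := integral_mono_ae (hφ.const_mul Q.ηc)
    (((hg.sub hg').add hN).add (integrable_const c)) hle
  rw [integral_const_mul, integral_add' ((hg.sub hg').add hN) (integrable_const c),
    integral_add' (hg.sub hg') hN, integral_sub' hg hg'] at h1
  simp only [integral_const, probReal_univ, smul_eq_mul, one_mul] at h1
  -- The noise costs only `2η²σ²/M`; the stated constant `5` leaves slack.
  have h2 : 0 ≤ Q.ηc ^ 2 * σ ^ 2 / M := by positivity
  have h3 : Q.ηc * (5 * σ ^ 2 * Q.ηc / M) = 5 * (Q.ηc ^ 2 * σ ^ 2 / M) := by ring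
  have h4 : Q.ηc * (20 * β ^ 2 * Q.ηc ^ 3 * Q.K ^ 2 * G ^ 2 + 5 * σ ^ 2 * Q.ηc / M
      + 2 * β * Q.ηc ^ 2 * Q.K ^ 2 * G ^ 2) = c + Q.ηc * (5 * σ ^ 2 * Q.ηc / M) := by
    rw [hcdef]; ring
  rw [h4, h3]
  linarith

/-- The convergence guarantee for an arbitrary step size. -/
theorem suboptimalityLE (hQ : IsStochasticProblem P Q f D ξ β σ G) {x₀ : E} (hx₀ : x₀ ∈ Q.X)
    (h₀ : Q.dualBar = grad Q.h x₀) {B : ℝ} (hB : ∀ x ∈ Q.X, bregman Q.h x₀ x ≤ B) {R : ℕ}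
    (hR : 0 < R) :
    SuboptimalityLE P Q.X (objective f Q.ψ) (fun ω => Q.output (path ξ ω) R)
      (B / (Q.ηc * R * Q.K) + 20 * β ^ 2 * Q.ηc ^ 3 * Q.K ^ 2 * G ^ 2 + 5 * σ ^ 2 * Q.ηc / M
          + 2 * β * Q.ηc ^ 2 * Q.K ^ 2 * G ^ 2) := by
  have hout := fun ω => hQ.output_mem hQ.K_pos hR (s := path ξ ω)
  have hcoe := fun ω => objective_eq_coe (f := f) (hout ω).2 (hQ.geom.reg.ne_bot _)
  have hη := hQ.ηc_pos
  have hR' : (0 : ℝ) < R := by exact_mod_cast hR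
  have hK' : (0 : ℝ) < Q.K := by exact_mod_cast hQ.K_pos
  have hsum : Integrable (fun ω => (1 / (R * Q.K) : ℝ) * ∑ r ∈ Finset.range R,
      ∑ k ∈ Finset.range Q.K, realObjective f Q.ψ (Q.shadowHalf (path ξ ω) r k)) P :=
    (integrable_finsetSum _ fun r _ => integrable_finsetSum _ fun k _ =>
      hQ.integrable_shadowHalf r k).const_mul _
  have hmeas : Measurable fun ω => Q.output (path ξ ω) R := by
    unfold output
    exact Measurable.const_smul (Finset.measurable_fun_sum _ fun r _ =>
      Finset.measurable_fun_sum _ fun k _ => hQ.measurable_shadowHalf r k) (1 / (R * Q.K) : ℝ)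
  have hint : Integrable (fun ω => realObjective f Q.ψ (Q.output (path ξ ω) R)) P := by
    obtain ⟨c, hc⟩ := hQ.exists_le_realObjective
    exact integrable_of_le_of_le
      (hQ.measurable_realObjective hmeas fun ω => (hout ω).1).aestronglyMeasurable
      (ae_of_all _ fun ω => hc _ (hout ω).1 (hout ω).2)
      (ae_of_all _ fun ω => hQ.realObjective_output_le hQ.K_pos hR)
      (integrable_const c) hsum
  refine ⟨fun ω => ⟨(hout ω).1, ?_, ?_⟩, ?_, fun x hx hfin => ?_⟩
  · simp only [hcoe]; exact EReal.coe_ne_bot _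
  · simp only [hcoe]; exact EReal.coe_ne_top _
  · simpa only [hcoe, EReal.toReal_coe] using hint
  have hψx := objective_ne_top_iff.1 hfin
  simp only [hcoe, objective_eq_coe (f := f) hψx (hQ.geom.reg.ne_bot _), EReal.toReal_coe]
  set c := 20 * β ^ 2 * Q.ηc ^ 3 * Q.K ^ 2 * G ^ 2 + 5 * σ ^ 2 * Q.ηc / M
    + 2 * β * Q.ηc ^ 2 * Q.K ^ 2 * G ^ 2 with hc
  set p : ℕ → ℕ → ℝ := fun r k =>
    ∫ ω, (realObjective f Q.ψ (Q.shadowHalf (path ξ ω) r k) - realObjective f Q.ψ x) ∂P with hp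
  set e : ℕ → ℕ → ℝ := fun r k => ∫ ω, Q.gap (path ξ ω) x r k ∂P with he
  -- The potential telescopes within a round, and `gap_next` glues consecutive rounds.
  have hround : ∀ r, ∑ k ∈ Finset.range Q.K, Q.ηc * p r k
      ≤ e r 0 - e (r + 1) 0 + Q.K * (Q.ηc * c) := by
    intro r
    have h1 : e (r + 1) 0 = e r Q.K := by simp only [he, hQ.gap_next]
    calc ∑ k ∈ Finset.range Q.K, Q.ηc * p r k
        ≤ ∑ k ∈ Finset.range Q.K, (e r k - e r (k + 1) + Q.ηc * c) :=
          Finset.sum_le_sum fun k hk => hQ.integral_step r k (Finset.mem_range.1 hk) hx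
      _ = _ := by
          rw [Finset.sum_add_distrib, Finset.sum_range_sub', h1, Finset.sum_const,
            Finset.card_range, nsmul_eq_mul]
  have htotal : ∑ r ∈ Finset.range R, ∑ k ∈ Finset.range Q.K, Q.ηc * p r k
      ≤ B + R * (Q.K * (Q.ηc * c)) := by
    have h1 : e 0 0 ≤ B := by
      calc e 0 0 ≤ ∫ _, B ∂P := integral_mono (hQ.integrable_gap x 0 0) (integrable_const B)
            fun ω => (hQ.gap_zero_le hx₀ h₀).trans (hB x hx)
        _ = B := by simp
    have h2 : 0 ≤ e R 0 := integral_nonneg fun ω => hQ.gap_nonneg hx hψx R 0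
    calc ∑ r ∈ Finset.range R, ∑ k ∈ Finset.range Q.K, Q.ηc * p r k
        ≤ ∑ r ∈ Finset.range R, (e r 0 - e (r + 1) 0 + Q.K * (Q.ηc * c)) :=
          Finset.sum_le_sum fun r _ => hround r
      _ = e 0 0 - e R 0 + R * (Q.K * (Q.ηc * c)) := by
          rw [Finset.sum_add_distrib, Finset.sum_range_sub' (fun r => e r 0), Finset.sum_const,
            Finset.card_range, nsmul_eq_mul]
      _ ≤ _ := by linarith
  have hjensen : ∫ ω, (realObjective f Q.ψ (Q.output (path ξ ω) R) - realObjective f Q.ψ x) ∂P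
      ≤ (1 / (R * Q.K) : ℝ) * ∑ r ∈ Finset.range R, ∑ k ∈ Finset.range Q.K, p r k := by
    have h1 : ∀ r k, p r k
        = ∫ ω, realObjective f Q.ψ (Q.shadowHalf (path ξ ω) r k) ∂P - realObjective f Q.ψ x := by
      intro r k
      simp only [hp]
      rw [integral_sub (hQ.integrable_shadowHalf r k) (integrable_const _)]
      simp
    have h2 := integral_mono hint hsum fun ω => hQ.realObjective_output_le hQ.K_pos hR
    rw [integral_const_mul, integral_finsetSum _ fun r _ => integrable_finsetSum _ fun k _ =>
      hQ.integrable_shadowHalf r k] at h2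
    simp only [integral_finsetSum _ fun k _ => hQ.integrable_shadowHalf _ k] at h2
    rw [integral_sub hint (integrable_const _)]
    simp only [h1, Finset.sum_sub_distrib, Finset.sum_const, Finset.card_range, nsmul_eq_mul,
      mul_sub, integral_const, probReal_univ, smul_eq_mul, one_mul]
    have h3 : (1 / (R * Q.K) : ℝ) * (R * (Q.K * realObjective f Q.ψ x)) = realObjective f Q.ψ x := by
      field_simp
    rw [h3]
    linarith
  refine hjensen.trans ?_
  simp only [← Finset.mul_sum] at htotal
  have h5 : (1 / (R * Q.K) : ℝ) * ∑ r ∈ Finset.range R, ∑ k ∈ Finset.range Q.K, p r k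
      ≤ B / (Q.ηc * R * Q.K) + c := by
    have e1 : B / (Q.ηc * R * Q.K) + c
        = (1 / (R * Q.K) : ℝ) * ((B + R * (Q.K * (Q.ηc * c))) / Q.ηc) := by
      field_simp
    rw [e1]
    refine mul_le_mul_of_nonneg_left ?_ (by positivity)
    rw [le_div_iff₀ hη]
    linarith
  rw [hc] at h5
  linarith

end IsStochasticProblem

/-! ### Tuned step size -/

section Tuning

lemma SuboptimalityLE.mono {E Ω : Type*} [MeasurableSpace Ω] {P : Measure Ω} {X : Set E}
    {φ : E → EReal} {z : Ω → E} {b b' : ℝ} (h : SuboptimalityLE P X φ z b) (hb : b ≤ b') :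
    SuboptimalityLE P X φ z b' :=
  ⟨h.1, h.2.1, fun x hx hx' => (h.2.2 x hx hx').trans hb⟩

lemma rpow_eq_pow {x : ℝ} (hx : 0 ≤ x) {p q : ℝ} (n : ℕ) (h : p = q * n) : x ^ p = (x ^ q) ^ n := by
  rw [h, Real.rpow_mul hx, Real.rpow_natCast]

lemma eq_rpow_pow {x : ℝ} (hx : 0 ≤ x) {q : ℝ} (n : ℕ) (h : 1 = q * n) : x = (x ^ q) ^ n := by
  rw [← rpow_eq_pow hx n h, Real.rpow_one]

variable {β G σ B : ℝ} {M K R : ℕ}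

lemma stepSize_pos (hβ : 0 < β) (hG : 0 < G) (hσ : 0 < σ) (hB : 0 < B) (hM : 0 < M) (hK : 0 < K)
    (hR : 0 < R) : 0 < stepSize β G σ B M K R := by
  have hM' : (0 : ℝ) < M := by exact_mod_cast hM
  have hK' : (0 : ℝ) < K := by exact_mod_cast hK
  have hR' : (0 : ℝ) < R := by exact_mod_cast hR
  unfold stepSize
  refine lt_min (lt_min ?_ ?_) (lt_min ?_ ?_) <;> positivity

/-- This candidate step size balances the initial-distance term against the drift term. Replacing
each base by a power of its root makes both identities rational; the next two lemmas proceed alike.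
-/
lemma drift_term_eq (hβ : 0 < β) (hG : 0 < G) (hB : 0 < B) {K R : ℝ} (hK : 0 < K) (hR : 0 < R)
    {η : ℝ} (hη : η = B ^ (1 / 4 : ℝ) / ((20 : ℝ) ^ (1 / 4 : ℝ) * β ^ (1 / 2 : ℝ) * G ^ (1 / 2 : ℝ)
        * K ^ (3 / 4 : ℝ) * R ^ (1 / 4 : ℝ))) :
    B / (η * R * K) = (20 : ℝ) ^ (1 / 4 : ℝ) * β ^ (1 / 2 : ℝ) * G ^ (1 / 2 : ℝ) * B ^ (3 / 4 : ℝ)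
      / (K ^ (1 / 4 : ℝ) * R ^ (3 / 4 : ℝ)) ∧
    20 * β ^ 2 * η ^ 3 * K ^ 2 * G ^ 2
      = (20 : ℝ) ^ (1 / 4 : ℝ) * β ^ (1 / 2 : ℝ) * G ^ (1 / 2 : ℝ) * B ^ (3 / 4 : ℝ)
      / (K ^ (1 / 4 : ℝ) * R ^ (3 / 4 : ℝ)) := by
  subst hη
  have e₁ := rpow_eq_pow hB.le (p := 3 / 4) (q := 1 / 4) 3 (by norm_num)
  have e₂ := rpow_eq_pow hK.le (p := 3 / 4) (q := 1 / 4) 3 (by norm_num)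
  have e₃ := rpow_eq_pow hR.le (p := 3 / 4) (q := 1 / 4) 3 (by norm_num)
  have f₁ := eq_rpow_pow hB.le (q := 1 / 4) 4 (by norm_num)
  have f₂ := eq_rpow_pow hK.le (q := 1 / 4) 4 (by norm_num)
  have f₃ := eq_rpow_pow hR.le (q := 1 / 4) 4 (by norm_num)
  have f₄ := eq_rpow_pow hβ.le (q := 1 / 2) 2 (by norm_num)
  have f₅ := eq_rpow_pow hG.le (q := 1 / 2) 2 (by norm_num)
  have f₆ := eq_rpow_pow (by norm_num : (0 : ℝ) ≤ 20) (q := 1 / 4) 4 (by norm_num)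
  have p₁ : 0 < B ^ (1 / 4 : ℝ) := by positivity
  have p₂ : 0 < K ^ (1 / 4 : ℝ) := by positivity
  have p₃ : 0 < R ^ (1 / 4 : ℝ) := by positivity
  have p₄ : 0 < β ^ (1 / 2 : ℝ) := by positivity
  have p₅ : 0 < G ^ (1 / 2 : ℝ) := by positivity
  have p₆ : 0 < (20 : ℝ) ^ (1 / 4 : ℝ) := by positivity
  rw [e₁, e₂, e₃]
  generalize B ^ (1 / 4 : ℝ) = b at *
  generalize K ^ (1 / 4 : ℝ) = k at *
  generalize R ^ (1 / 4 : ℝ) = r at *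
  generalize β ^ (1 / 2 : ℝ) = c at *
  generalize G ^ (1 / 2 : ℝ) = g at *
  generalize (20 : ℝ) ^ (1 / 4 : ℝ) = t at *
  rw [f₁, f₂, f₃, f₄, f₅, f₆]
  constructor <;> field_simp

lemma variance_term_eq (hσ : 0 < σ) (hB : 0 < B) {M K R : ℝ} (hM : 0 < M) (hK : 0 < K)
    (hR : 0 < R) {η : ℝ} (hη : η = B ^ (1 / 2 : ℝ) * M ^ (1 / 2 : ℝ) / ((5 : ℝ) ^ (1 / 2 : ℝ) * σ
        * R ^ (1 / 2 : ℝ) * K ^ (1 / 2 : ℝ))) :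
    B / (η * R * K) = (5 : ℝ) ^ (1 / 2 : ℝ) * σ * B ^ (1 / 2 : ℝ)
      / (M ^ (1 / 2 : ℝ) * R ^ (1 / 2 : ℝ) * K ^ (1 / 2 : ℝ)) ∧
    5 * σ ^ 2 * η / M = (5 : ℝ) ^ (1 / 2 : ℝ) * σ * B ^ (1 / 2 : ℝ)
      / (M ^ (1 / 2 : ℝ) * R ^ (1 / 2 : ℝ) * K ^ (1 / 2 : ℝ)) := by
  subst hη
  have f₁ := eq_rpow_pow hB.le (q := 1 / 2) 2 (by norm_num)
  have f₂ := eq_rpow_pow hK.le (q := 1 / 2) 2 (by norm_num)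
  have f₃ := eq_rpow_pow hR.le (q := 1 / 2) 2 (by norm_num)
  have f₄ := eq_rpow_pow hM.le (q := 1 / 2) 2 (by norm_num)
  have f₅ := eq_rpow_pow (by norm_num : (0 : ℝ) ≤ 5) (q := 1 / 2) 2 (by norm_num)
  have p₁ : 0 < B ^ (1 / 2 : ℝ) := by positivity
  have p₂ : 0 < K ^ (1 / 2 : ℝ) := by positivity
  have p₃ : 0 < R ^ (1 / 2 : ℝ) := by positivity
  have p₄ : 0 < M ^ (1 / 2 : ℝ) := by positivity
  have p₅ : 0 < (5 : ℝ) ^ (1 / 2 : ℝ) := by positivity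
  generalize B ^ (1 / 2 : ℝ) = b at *
  generalize K ^ (1 / 2 : ℝ) = k at *
  generalize R ^ (1 / 2 : ℝ) = r at *
  generalize M ^ (1 / 2 : ℝ) = c at *
  generalize (5 : ℝ) ^ (1 / 2 : ℝ) = t at *
  rw [f₁, f₂, f₃, f₄, f₅]
  constructor <;> field_simp

lemma smoothness_term_eq (hβ : 0 < β) (hG : 0 < G) (hB : 0 < B) {K R : ℝ} (hK : 0 < K)
    (hR : 0 < R) {η : ℝ} (hη : η = B ^ (1 / 3 : ℝ) / ((2 : ℝ) ^ (1 / 3 : ℝ) * β ^ (1 / 3 : ℝ)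
        * G ^ (2 / 3 : ℝ) * K * R ^ (1 / 3 : ℝ))) :
    B / (η * R * K) = (2 : ℝ) ^ (1 / 3 : ℝ) * β ^ (1 / 3 : ℝ) * G ^ (2 / 3 : ℝ) * B ^ (2 / 3 : ℝ)
      / R ^ (2 / 3 : ℝ) ∧
    2 * β * η ^ 2 * K ^ 2 * G ^ 2
      = (2 : ℝ) ^ (1 / 3 : ℝ) * β ^ (1 / 3 : ℝ) * G ^ (2 / 3 : ℝ) * B ^ (2 / 3 : ℝ)
      / R ^ (2 / 3 : ℝ) := by
  subst hη
  have e₁ := rpow_eq_pow hB.le (p := 2 / 3) (q := 1 / 3) 2 (by norm_num)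
  have e₂ := rpow_eq_pow hG.le (p := 2 / 3) (q := 1 / 3) 2 (by norm_num)
  have e₃ := rpow_eq_pow hR.le (p := 2 / 3) (q := 1 / 3) 2 (by norm_num)
  have f₁ := eq_rpow_pow hB.le (q := 1 / 3) 3 (by norm_num)
  have f₂ := eq_rpow_pow hG.le (q := 1 / 3) 3 (by norm_num)
  have f₃ := eq_rpow_pow hR.le (q := 1 / 3) 3 (by norm_num)
  have f₄ := eq_rpow_pow hβ.le (q := 1 / 3) 3 (by norm_num)
  have f₅ := eq_rpow_pow (by norm_num : (0 : ℝ) ≤ 2) (q := 1 / 3) 3 (by norm_num)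
  have p₁ : 0 < B ^ (1 / 3 : ℝ) := by positivity
  have p₂ : 0 < G ^ (1 / 3 : ℝ) := by positivity
  have p₃ : 0 < R ^ (1 / 3 : ℝ) := by positivity
  have p₄ : 0 < β ^ (1 / 3 : ℝ) := by positivity
  have p₅ : 0 < (2 : ℝ) ^ (1 / 3 : ℝ) := by positivity
  have hb : 2 * β * G ^ 2 = ((2 : ℝ) ^ (1 / 3 : ℝ) * β ^ (1 / 3 : ℝ)) ^ 3 * G ^ 2 := by
    rw [mul_pow, ← f₄, ← f₅]
  have hb' : 2 * β * (B ^ (1 / 3 : ℝ) / ((2 : ℝ) ^ (1 / 3 : ℝ) * β ^ (1 / 3 : ℝ)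
        * G ^ (2 / 3 : ℝ) * K * R ^ (1 / 3 : ℝ))) ^ 2 * K ^ 2 * G ^ 2
      = 2 * β * G ^ 2 * (B ^ (1 / 3 : ℝ) / ((2 : ℝ) ^ (1 / 3 : ℝ) * β ^ (1 / 3 : ℝ)
        * G ^ (2 / 3 : ℝ) * K * R ^ (1 / 3 : ℝ))) ^ 2 * K ^ 2 := by ring
  rw [hb', hb, e₁, e₂, e₃]
  clear hb hb'
  generalize B ^ (1 / 3 : ℝ) = b at *
  generalize G ^ (1 / 3 : ℝ) = g at *
  generalize R ^ (1 / 3 : ℝ) = r at *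
  generalize β ^ (1 / 3 : ℝ) = c at *
  generalize (2 : ℝ) ^ (1 / 3 : ℝ) = t at *
  rw [f₁, f₂, f₃]
  constructor <;> field_simp

/-- The bound for an arbitrary step size, evaluated at the tuned step size. -/
lemma bound_stepSize_le (hβ : 0 < β) (hG : 0 < G) (hσ : 0 < σ) (hB : 0 < B) (hM : 0 < M)
    (hK : 0 < K) (hR : 0 < R) {η : ℝ} (hη : η = stepSize β G σ B M K R) :
    B / (η * R * K) + 20 * β ^ 2 * η ^ 3 * K ^ 2 * G ^ 2 + 5 * σ ^ 2 * η / M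
        + 2 * β * η ^ 2 * K ^ 2 * G ^ 2
      ≤ 5 * β ^ 2 * B / (R * K)
          + 2 * ((20 : ℝ) ^ (1 / 4 : ℝ) * β ^ (1 / 2 : ℝ) * G ^ (1 / 2 : ℝ) * B ^ (3 / 4 : ℝ)
            / ((K : ℝ) ^ (1 / 4 : ℝ) * (R : ℝ) ^ (3 / 4 : ℝ)))
          + 2 * ((5 : ℝ) ^ (1 / 2 : ℝ) * σ * B ^ (1 / 2 : ℝ)
            / ((M : ℝ) ^ (1 / 2 : ℝ) * (R : ℝ) ^ (1 / 2 : ℝ) * (K : ℝ) ^ (1 / 2 : ℝ)))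
          + 2 * ((2 : ℝ) ^ (1 / 3 : ℝ) * β ^ (1 / 3 : ℝ) * G ^ (2 / 3 : ℝ) * B ^ (2 / 3 : ℝ)
            / (R : ℝ) ^ (2 / 3 : ℝ)) := by
  have hM' : (0 : ℝ) < M := by exact_mod_cast hM
  have hK' : (0 : ℝ) < K := by exact_mod_cast hK
  have hR' : (0 : ℝ) < R := by exact_mod_cast hR
  have hpos : 0 < η := hη ▸ stepSize_pos hβ hG hσ hB hM hK hR
  obtain ⟨η₁, h₁⟩ : ∃ x, x = 1 / (5 * β ^ 2) := ⟨_, rfl⟩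
  obtain ⟨η₂, h₂⟩ : ∃ x, x = B ^ (1 / 4 : ℝ) / ((20 : ℝ) ^ (1 / 4 : ℝ) * β ^ (1 / 2 : ℝ)
    * G ^ (1 / 2 : ℝ) * (K : ℝ) ^ (3 / 4 : ℝ) * (R : ℝ) ^ (1 / 4 : ℝ)) := ⟨_, rfl⟩
  obtain ⟨η₃, h₃⟩ : ∃ x, x = B ^ (1 / 2 : ℝ) * (M : ℝ) ^ (1 / 2 : ℝ) / ((5 : ℝ) ^ (1 / 2 : ℝ) * σ
    * (R : ℝ) ^ (1 / 2 : ℝ) * (K : ℝ) ^ (1 / 2 : ℝ)) := ⟨_, rfl⟩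
  obtain ⟨η₄, h₄⟩ : ∃ x, x = B ^ (1 / 3 : ℝ) / ((2 : ℝ) ^ (1 / 3 : ℝ) * β ^ (1 / 3 : ℝ)
    * G ^ (2 / 3 : ℝ) * K * (R : ℝ) ^ (1 / 3 : ℝ)) := ⟨_, rfl⟩
  have hmin : η = min (min η₁ η₂) (min η₃ η₄) := by rw [hη, h₁, h₂, h₃, h₄]; rfl
  obtain ⟨a₂, b₂⟩ := drift_term_eq hβ hG hB hK' hR' h₂
  obtain ⟨a₃, b₃⟩ := variance_term_eq hσ hB hM' hK' hR' h₃
  obtain ⟨a₄, b₄⟩ := smoothness_term_eq hβ hG hB hK' hR' h₄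
  have a₁ : B / (η₁ * R * K) = 5 * β ^ 2 * B / (R * K) := by rw [h₁]; field_simp
  have q₁ : 0 < η₁ := by rw [h₁]; positivity
  have q₂ : 0 < η₂ := by rw [h₂]; positivity
  have q₃ : 0 < η₃ := by rw [h₃]; positivity
  have q₄ : 0 < η₄ := by rw [h₄]; positivity
  rw [← a₁]
  have l₂ : η ≤ η₂ := hmin ▸ (min_le_left _ _).trans (min_le_right _ _)
  have l₃ : η ≤ η₃ := hmin ▸ (min_le_right _ _).trans (min_le_left _ _)
  have l₄ : η ≤ η₄ := hmin ▸ (min_le_right _ _).trans (min_le_right _ _)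
  have d₂ : 20 * β ^ 2 * η ^ 3 * K ^ 2 * G ^ 2 ≤ 20 * β ^ 2 * η₂ ^ 3 * K ^ 2 * G ^ 2 := by gcongr
  have d₃ : 5 * σ ^ 2 * η / M ≤ 5 * σ ^ 2 * η₃ / M := by gcongr
  have d₄ : 2 * β * η ^ 2 * K ^ 2 * G ^ 2 ≤ 2 * β * η₄ ^ 2 * K ^ 2 * G ^ 2 := by gcongr
  have s₁ : 0 < B / (η₁ * R * K) := by positivity
  have s₂ : 0 < B / (η₂ * R * K) := by positivity
  have s₃ : 0 < B / (η₃ * R * K) := by positivity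
  have s₄ : 0 < B / (η₄ * R * K) := by positivity
  -- The minimum is attained by one candidate and the other summands are positive; the remaining
  -- error terms are monotone in `η`, so each is evaluated at its own candidate.
  have hmain : B / (η * R * K) ≤ B / (η₁ * R * K) + B / (η₂ * R * K) + B / (η₃ * R * K)
      + B / (η₄ * R * K) := by
    have : η = η₁ ∨ η = η₂ ∨ η = η₃ ∨ η = η₄ := by
      rw [hmin]
      rcases min_choice (min η₁ η₂) (min η₃ η₄) with h | h <;> rw [h]
      · rcases min_choice η₁ η₂ with h | h <;> simp [h]
      · rcases min_choice η₃ η₄ with h | h <;> simp [h]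
    rcases this with h | h | h | h <;> rw [h] <;> linarith
  linarith

end Tuning

/-- Strong convexity turns the bound on the divergence into `‖x - y‖² ≤ 2B`, so the closed set `X`
is bounded, hence compact. -/
lemma isGeometry_of_bregman_le {E : Type*} [NormedAddCommGroup E] [NormedSpace ℝ E]
    [FiniteDimensional ℝ E] {X : Set E} {h ψ : E → EReal} {B : ℝ} (hX : IsClosed X)
    (hconv : Convex ℝ X) (hLeg : IsLegendre h) (hStrong : IsOneStronglyConvex h)
    (hXint : X ⊆ interior (effDom h)) (hB : ∀ x ∈ X, ∀ x' ∈ X, bregman h x' x ≤ B)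
    (hψ : IsClosedConvexFun ψ) (hψX : ∃ x ∈ X, ψ x ≠ ⊤) : IsGeometry X h ψ where
  compact := by
    have := FiniteDimensional.proper_real E
    refine Metric.isCompact_of_isClosed_isBounded hX ?_
    refine Metric.isBounded_iff.2 ⟨1 + 2 * B, fun x hx y hy => ?_⟩
    have h1 := (hStrong y (hXint hy) x (interior_subset (hXint hx))).trans (hB x hx y hy)
    rw [dist_eq_norm]
    -- The bound `1 + 2B` avoids a square root: `2‖x - y‖ ≤ ‖x - y‖² + 1`.
    nlinarith [sq_nonneg (‖x - y‖ - 1)]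
  convex := hconv
  legendre := hLeg
  strong := hStrong
  interior := hXint
  reg := hψ
  exists_finite := hψX

end FeDualEx

end

theorem theorem2
    {E Ξ Ω : Type*} [NormedAddCommGroup E] [NormedSpace ℝ E] [FiniteDimensional ℝ E]
    [MeasurableSpace E] [BorelSpace E] [MeasurableSpace Ξ] [MeasurableSpace Ω]
    (P : Measure Ω) [IsProbabilityMeasure P]
    (M K R : ℕ) (hM : 0 < M) (hK : 0 < K) (hR : 0 < R)
    (β G σ B : ℝ) (hβ : 0 ≤ β) (hσ : 0 ≤ σ)
    -- the domain, the distance-generating function, and the regularizer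
    (X : Set E) (hXclosed : IsClosed X)
    (h : E → EReal) (hLeg : FeDualEx.IsLegendre h) (hStrong : FeDualEx.IsOneStronglyConvex h)
    (hXint : X ⊆ interior (FeDualEx.effDom h))
    (hB : ∀ x ∈ X, ∀ x' ∈ X, FeDualEx.bregman h x' x ≤ B)
    (ψ : E → EReal) (hψ : FeDualEx.IsClosedConvexFun ψ) (hψX : ∃ x ∈ X, ψ x ≠ ⊤)
    -- convex `β`-smooth client objectives
    (f : Fin M → E → ℝ) (hfconv : ∀ m, ConvexOn ℝ X (f m))
    (hfdiff : ∀ m, ∀ x ∈ X, DifferentiableAt ℝ (f m) x)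
    (hfsmooth : ∀ m, ∀ x ∈ X, ∀ x' ∈ X,
      f m x ≤ f m x' + fderiv ℝ (f m) x' (x - x') + β / 2 * ‖x - x'‖ ^ 2)
    -- stochastic gradients: unbiased, variance at most `σ²`, bounded by `G`
    (D : Fin M → Measure Ξ) (g : Fin M → E → Ξ → (E →L[ℝ] ℝ))
    (hgmeas : ∀ m, Measurable (fun p : E × Ξ => g m p.1 p.2))
    (hgunb : ∀ m, ∀ x ∈ X, ∫ ξ, g m x ξ ∂(D m) = fderiv ℝ (f m) x)
    (hgvar : ∀ m, ∀ x ∈ X, ∫ ξ, ‖g m x ξ - fderiv ℝ (f m) x‖ ^ 2 ∂(D m) ≤ σ ^ 2)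
    (hgbdd : ∀ m, ∀ x ∈ X, ∀ᵐ ξ ∂(D m), ‖g m x ξ‖ ≤ G)
    -- independent samples, those of client `m` with law `D m`
    (ξ : Fin M → ℕ → ℕ → Bool → Ω → Ξ) (hξmeas : ∀ m r k b, Measurable (ξ m r k b))
    (hξlaw : ∀ m r k b, Measure.map (ξ m r k b) P = D m)
    (hξindep : iIndepFun
      (fun (i : Fin M × ℕ × ℕ × Bool) => ξ i.1 i.2.1 i.2.2.1 i.2.2.2) P)
    -- initialization at the dual image of a feasible point
    (x₀ : E) (hx₀ : x₀ ∈ X) :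
    -- the bound for every client step size `η` (server step size `1`)
    (∀ η : ℝ, 0 < η →
      FeDualEx.SuboptimalityLE P X (FeDualEx.objective f ψ)
        (fun ω => FeDualEx.Input.output
          { X := X, h := h, ψ := ψ, oracle := g, dualBar := FeDualEx.grad h x₀,
            K := K, ηc := η, ηs := 1 }
          (fun m r k b => ξ m r k b ω) R)
        (B / (η * R * K) + 20 * β ^ 2 * η ^ 3 * K ^ 2 * G ^ 2 + 5 * σ ^ 2 * η / M
          + 2 * β * η ^ 2 * K ^ 2 * G ^ 2)) ∧
    -- the rate for the tuned step size
    (0 < β → 0 < G → 0 < σ → 0 < B →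
      FeDualEx.SuboptimalityLE P X (FeDualEx.objective f ψ)
        (fun ω => FeDualEx.Input.output
          { X := X, h := h, ψ := ψ, oracle := g, dualBar := FeDualEx.grad h x₀,
            K := K, ηc := FeDualEx.stepSize β G σ B M K R, ηs := 1 }
          (fun m r k b => ξ m r k b ω) R)
        (5 * β ^ 2 * B / (R * K)
          + 2 * ((20 : ℝ) ^ (1 / 4 : ℝ) * β ^ (1 / 2 : ℝ) * G ^ (1 / 2 : ℝ) * B ^ (3 / 4 : ℝ)
            / ((K : ℝ) ^ (1 / 4 : ℝ) * (R : ℝ) ^ (3 / 4 : ℝ)))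
          + 2 * ((5 : ℝ) ^ (1 / 2 : ℝ) * σ * B ^ (1 / 2 : ℝ)
            / ((M : ℝ) ^ (1 / 2 : ℝ) * (R : ℝ) ^ (1 / 2 : ℝ) * (K : ℝ) ^ (1 / 2 : ℝ)))
          + 2 * ((2 : ℝ) ^ (1 / 3 : ℝ) * β ^ (1 / 3 : ℝ) * G ^ (2 / 3 : ℝ) * B ^ (2 / 3 : ℝ)
            / (R : ℝ) ^ (2 / 3 : ℝ)))) := by
  have hD : ∀ m, IsProbabilityMeasure (D m) := fun m => by
    rw [← hξlaw m 0 0 false]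
    exact Measure.isProbabilityMeasure_map (hξmeas m 0 0 false).aemeasurable
  have hgeom : FeDualEx.IsGeometry X h ψ :=
    FeDualEx.isGeometry_of_bregman_le hXclosed (hfconv ⟨0, hM⟩).1 hLeg hStrong hXint hB hψ hψX
  have horacle : ∀ m, FeDualEx.IsOracle X (D m) (g m) (fderiv ℝ (f m)) σ G := fun m =>
    ⟨hgmeas m, hgunb m, hgvar m, hgbdd m⟩
  have hproblem : ∀ η : ℝ, 0 < η → FeDualEx.IsStochasticProblem P
      { X := X, h := h, ψ := ψ, oracle := g, dualBar := FeDualEx.grad h x₀, K := K, ηc := η,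
        ηs := 1 } f D ξ β σ G := fun η hη =>
    { geom := hgeom
      clients_pos := hM
      ηc_pos := hη
      ηs_eq := rfl
      β_nonneg := hβ
      smooth := fun m => ⟨hfconv m, hfdiff m, hfsmooth m⟩
      norm_fderiv_le := fun m x hx => (horacle m).norm_grad_le hx
      K_pos := hK
      oracle := horacle
      measurable_sample := hξmeas
      law := hξlaw
      indep := hξindep }
  have hbound := fun η hη =>
    (hproblem η hη).suboptimalityLE hx₀ rfl (fun x hx => hB x hx x₀ hx₀) hR
  exact ⟨hbound, fun hβ' hG' hσ' hB' =>
    (hbound _ (FeDualEx.stepSize_pos hβ' hG' hσ' hB' hM hK hR)).mono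
      (FeDualEx.bound_stepSize_le hβ' hG' hσ' hB' hM hK hR rfl)⟩
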